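/- Let $a>-1$ be fixed. For $N\ge 1$ let $\rho_N(x)$ be the eigenvalue density (one-point correlation function, of total mass $N$) of the Laguerre unitary ensemble, i.e. of the probability density on $\mathbb R^N$ proportional to $$\prod_{l=1}^N x_l^a e^{-x_l}\mathbf 1_{x_l>0}\prod_{1\le j<k\le N}|x_k-x_j|^2 .$$ Put $N_{\rm h}'=N+a/2$ and let $\rho_N^{\rm h}(y)=\frac{1}{4N_{\rm h}'}\,\rho_N\!\big(\tfrac{y}{4N_{\rm h}'}\big)$ be the hard-edge scaled density. Let $J_\nu$ be the Bessel function of the first kind and write $J_a'(\sqrt y)=J_a'(u)|_{u=\sqrt y}$. Then, for each fixed $y>0$, as $N\to\infty$, $$\rho_N^{\rm h}(y)=r_0(y)+\frac{r_1(y)}{(N_{\rm h}')^{2}}+\frac{r_2(y)}{(N_{\rm h}')^{4}}+O\big((N_{\rm h}')^{-6}\big),$$ where $$r_0(y)=\tfrac14\big(J_a(\sqrt y)^2-J_{a+1}(\sqrt y)J_{a-1}(\sqrt y)\big),$$ $$r_1(y)=-\tfrac1{192}\big((2y+a^2)J_a(\sqrt y)^2+4\sqrt y\,J_a(\sqrt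 y)J_a'(\sqrt y)+y\,J_a'(\sqrt y)^2\big),$$ $$r_2(y)=\alpha_2(y)\,\frac1y J_a(\sqrt y)^2+\beta_2(y)\,J_a'(\sqrt y)^2+\gamma_2(y)\,\frac1{\sqrt y}J_a(\sqrt y)J_a'(\sqrt y),$$ with $$\alpha_2(y)=\frac{y}{92160}\big(14a^2(-4+a^2)+2(48-9a^2)y-26y^2\big),$$ $$\beta_2(y)=\frac{y}{92160}\big(14(-4+a^2)+6y\big),$$ $$\gamma_2(y)=\frac{y}{92160}\big(192-128a^2+20a^4+(-104+20a^2)y+5y^2\big).$$ -/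

import Mathlib

open Filter Asymptotics

noncomputable section

namespace LUEHardEdge

/-- The Laguerre weight `x ^ a * e ^ (-x)` on `x > 0`, extended by `0`. -/
def weight (a x : ℝ) : ℝ :=
  (Set.Ioi (0 : ℝ)).indicator (fun t : ℝ => t ^ a * Real.exp (-t)) x

/-- The unnormalised joint eigenvalue density of the Laguerre unitary ensemble (`β = 2`). -/
def jointWeight (a : ℝ) {N : ℕ} (x : Fin N → ℝ) : ℝ :=
  (∏ l, weight a (x l)) * ∏ j, ∏ k ∈ Finset.Ioi j, |x k - x j| ^ 2

/-- The normalisation constant of the joint eigenvalue density. -/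
def partitionFunction (a : ℝ) (N : ℕ) : ℝ :=
  ∫ x : Fin N → ℝ, jointWeight a x

/-- The eigenvalue density (one-point function) of the Laguerre unitary ensemble of `N`
eigenvalues: `N` times the marginal of one eigenvalue, so that its total mass is `N`. -/
def density (a : ℝ) : ℕ → ℝ → ℝ
  | 0, _ => 0
  | n + 1, x =>
      ((n + 1 : ℕ) : ℝ) / partitionFunction a (n + 1) *
        ∫ t : Fin n → ℝ, jointWeight a (Fin.cons x t : Fin (n + 1) → ℝ)

/-- The shifted size `N + a / 2`. -/
def shiftedSize (a : ℝ) (N : ℕ) : ℝ := (N : ℝ) + a / 2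

/-- The hard edge scaled density. -/
def hardEdgeDensity (a : ℝ) (N : ℕ) (y : ℝ) : ℝ :=
  1 / (4 * shiftedSize a N) * density a N (y / (4 * shiftedSize a N))

/-- The Bessel function of the first kind of real order `ν`, at arguments `u > 0`. At a pole of
the Gamma function `Real.Gamma` is `0`, and so is the quotient, as it should be for `1 / Γ`. -/
def besselJ (ν u : ℝ) : ℝ :=
  ∑' m : ℕ, (-1 : ℝ) ^ m / ((m.factorial : ℝ) * Real.Gamma ((m : ℝ) + ν + 1)) *
    (u / 2) ^ (2 * (m : ℝ) + ν)

/-- The derivative of the Bessel function with respect to its argument. -/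
def besselJ' (ν u : ℝ) : ℝ := deriv (besselJ ν) u

/-- The limiting hard edge density. -/
def r₀ (a y : ℝ) : ℝ :=
  1 / 4 * (besselJ a (√y) ^ 2 - besselJ (a + 1) (√y) * besselJ (a - 1) (√y))

/-- The first correction. -/
def r₁ (a y : ℝ) : ℝ :=
  -(1 / 192) * ((2 * y + a ^ 2) * besselJ a (√y) ^ 2
    + 4 * √y * besselJ a (√y) * besselJ' a (√y) + y * besselJ' a (√y) ^ 2)

/-- Coefficient of `J_a(√y) ^ 2 / y` in the second correction. -/
def α₂ (a y : ℝ) : ℝ :=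
  y / 92160 * (14 * a ^ 2 * (-4 + a ^ 2) + 2 * (48 - 9 * a ^ 2) * y - 26 * y ^ 2)

/-- Coefficient of `J_a'(√y) ^ 2` in the second correction. -/
def β₂ (a y : ℝ) : ℝ :=
  y / 92160 * (14 * (-4 + a ^ 2) + 6 * y)

/-- Coefficient of `J_a(√y) * J_a'(√y) / √y` in the second correction. -/
def γ₂ (a y : ℝ) : ℝ :=
  y / 92160 * (192 - 128 * a ^ 2 + 20 * a ^ 4 + (-104 + 20 * a ^ 2) * y + 5 * y ^ 2)

/-- The second correction. -/
def r₂ (a y : ℝ) : ℝ :=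
  α₂ a y * (1 / y * besselJ a (√y) ^ 2) + β₂ a y * besselJ' a (√y) ^ 2
    + γ₂ a y * (1 / √y * besselJ a (√y) * besselJ' a (√y))

end LUEHardEdge

end

/-! Orthogonality of the monic Laguerre polynomials turns the density into a Christoffel–Darboux sum
(`density_succ_eq`). That sum collapses to a quadratic form in `g` and `x g'`, where `g` is the
single Laguerre polynomial of degree n = N - 1 and parameter α = a + 1 (`sum_laguerre_sq`).

The shifted size κ = N + a/2 equals n + (α + 1)/2, and f = exp(-x/2) g solves x f'' + (α + 1) f' +
(κ - x/4) f = 0. In the variable y = 4κx this reads y F'' + (α + 1) F' + (1/4 - ε y/64) F = 0 with ε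
= κ⁻². This is Bessel's equation perturbed by a term in ε alone, hence the even powers of κ.

On power series, the Bessel coefficients are multiplied by factors t_m(ε) obeying a two-step
recursion (`laguerreSeries_coeff`). The ε and ε² coefficients of t_m are polynomials in m, so the
corrections are polynomials in the Euler operator y d/dy applied to the Bessel series. The remainder
is at most ε³ t_m(1) (`abs_finiteSizeFactor_sub_le`), which is summable against the Bessel
coefficients.

The remaining prefactor Γ(n + α + 1)/(n! κ^α) also expands in κ⁻² (`hasExpansion_gammaRatio`),
because κ + 1/2 is the midpoint of n + 1 and n + α + 1. Multiplying the expansions and reducing all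
Euler powers to the first two by Bessel's equation (`besselMoment_add_two`) leaves polynomial
identities for `r₀`, `r₁`, `r₂`. -/

noncomputable section

namespace LUEHardEdge

section

open Polynomial MeasureTheory Finset

/-! ### One-point functions of orthogonal polynomial ensembles -/

section OrthogonalPolynomials

variable {w : ℝ → ℝ} {p : ℕ → ℝ[X]} {h : ℕ → ℝ}

/-- The squared Vandermonde product as a double sum over permutations, for any monic family. -/
lemma prod_abs_sub_sq_eq_sum (hdeg : ∀ k, (p k).natDegree = k) (hmonic : ∀ k, (p k).Monic)
    {n : ℕ} (x : Fin n → ℝ) :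
    ∏ j, ∏ k ∈ Finset.Ioi j, |x k - x j| ^ 2 =
      ∑ σ : Equiv.Perm (Fin n), ∑ τ : Equiv.Perm (Fin n),
        ((Equiv.Perm.sign σ : ℤ) : ℝ) * ((Equiv.Perm.sign τ : ℤ) : ℝ) *
          ∏ i, ((p (σ i)).eval (x i) * (p (τ i)).eval (x i)) := by
  have hdet : ∏ j, ∏ k ∈ Finset.Ioi j, (x k - x j) =
      ∑ σ : Equiv.Perm (Fin n), ((Equiv.Perm.sign σ : ℤ) : ℝ) * ∏ i, (p (σ i)).eval (x i) := by
    rw [← Matrix.det_vandermonde,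
      Matrix.det_eval_matrixOfPolynomials_eq_det_vandermonde x (fun i : Fin n => p i)
        (fun i => hdeg i) (fun i => hmonic i), ← Matrix.det_transpose, Matrix.det_apply']
    simp
  simp_rw [sq_abs, Finset.prod_pow, hdet, sq, Finset.sum_mul_sum, Finset.prod_mul_distrib]
  refine Finset.sum_congr rfl fun σ _ => Finset.sum_congr rfl fun τ _ => ?_
  ring

lemma prod_weight_mul_prod_abs_sub_sq_eq_sum (hdeg : ∀ k, (p k).natDegree = k)
    (hmonic : ∀ k, (p k).Monic) {n : ℕ} (x : Fin n → ℝ) :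
    (∏ l, w (x l)) * ∏ j, ∏ k ∈ Finset.Ioi j, |x k - x j| ^ 2 =
      ∑ σ : Equiv.Perm (Fin n), ∑ τ : Equiv.Perm (Fin n),
        ((Equiv.Perm.sign σ : ℤ) : ℝ) * ((Equiv.Perm.sign τ : ℤ) : ℝ) *
          ∏ i, ((p (σ i)).eval (x i) * (p (τ i)).eval (x i) * w (x i)) := by
  rw [prod_abs_sub_sq_eq_sum hdeg hmonic, Finset.mul_sum]
  refine Finset.sum_congr rfl fun σ _ => ?_
  rw [Finset.mul_sum]
  refine Finset.sum_congr rfl fun τ _ => ?_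
  rw [Finset.prod_mul_distrib (g := fun i => w (x i))]
  ring

lemma sign_mul_sign_self {n : ℕ} (σ : Equiv.Perm (Fin n)) :
    ((Equiv.Perm.sign σ : ℤ) : ℝ) * ((Equiv.Perm.sign σ : ℤ) : ℝ) = 1 := by
  rcases Int.units_eq_one_or (Equiv.Perm.sign σ) with h | h <;> simp [h]

/-- The normalisation of an orthogonal polynomial ensemble. -/
lemma integral_prod_weight_mul_prod_abs_sub_sq
    (hdeg : ∀ k, (p k).natDegree = k) (hmonic : ∀ k, (p k).Monic)
    (h_integrable : ∀ i j, Integrable fun t => (p i).eval t * (p j).eval t * w t)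
    (horth : ∀ i j, ∫ t, (p i).eval t * (p j).eval t * w t = if i = j then h i else 0) (n : ℕ) :
    ∫ x : Fin n → ℝ, (∏ l, w (x l)) * ∏ j, ∏ k ∈ Finset.Ioi j, |x k - x j| ^ 2 =
      n.factorial * ∏ k ∈ range n, h k := by
  have hI (σ τ : Equiv.Perm (Fin n)) : Integrable fun x : Fin n → ℝ =>
      ((Equiv.Perm.sign σ : ℤ) : ℝ) * ((Equiv.Perm.sign τ : ℤ) : ℝ) *
          ∏ i, ((p (σ i)).eval (x i) * (p (τ i)).eval (x i) * w (x i)) :=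
    (Integrable.fintype_prod (f := fun i t => (p (σ i)).eval t * (p (τ i)).eval t * w t)
      fun i => h_integrable _ _).const_mul _
  simp_rw [prod_weight_mul_prod_abs_sub_sq_eq_sum hdeg hmonic]
  rw [integral_finsetSum _ fun σ _ => integrable_finsetSum _ fun τ _ => hI σ τ]
  have hval (σ : Equiv.Perm (Fin n)) : ∫ x : Fin n → ℝ, ∑ τ : Equiv.Perm (Fin n),
      ((Equiv.Perm.sign σ : ℤ) : ℝ) * ((Equiv.Perm.sign τ : ℤ) : ℝ) *
          ∏ i, ((p (σ i)).eval (x i) * (p (τ i)).eval (x i) * w (x i)) =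
      ∏ k ∈ range n, h k := by
    -- By orthogonality a pair of permutations contributes only if they agree at every index.
    rw [integral_finsetSum _ fun τ _ => hI σ τ, Finset.sum_eq_single σ]
    · rw [integral_const_mul, sign_mul_sign_self, one_mul,
        integral_fintype_prod_volume_eq_prod
          (fun i t => (p (σ i)).eval t * (p (σ i)).eval t * w t)]
      simp_rw [horth, if_true]
      rw [Equiv.prod_comp σ (fun i : Fin n => h i), Finset.prod_range]
    · intro τ _ hτ
      obtain ⟨i, hi⟩ : ∃ i, σ i ≠ τ i := by
        by_contra! hc
        exact hτ (Equiv.ext fun i => (hc i).symm)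
      rw [integral_const_mul, integral_fintype_prod_volume_eq_prod
          (fun i t => (p (σ i)).eval t * (p (τ i)).eval t * w t),
        Finset.prod_eq_zero (Finset.mem_univ i), mul_zero]
      rw [horth, if_neg]
      exact fun hc => hi (Fin.ext hc)
    · simp
  simp_rw [hval]
  simp [Finset.card_univ, Fintype.card_perm]

/-- Each value of σ 0 is attained by exactly n! permutations. -/
lemma sum_perm_apply_zero {n : ℕ} (f : Fin (n + 1) → ℝ) :
    ∑ σ : Equiv.Perm (Fin (n + 1)), f (σ 0) = n.factorial * ∑ k, f k := by
  rw [← Equiv.sum_comp (Equiv.Perm.decomposeFin (n := n)).symm, Fintype.sum_prod_type]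
  simp [Equiv.Perm.decomposeFin_symm_apply_zero, Fintype.card_perm, Finset.mul_sum]

/-- The marginal of an orthogonal polynomial ensemble. -/
lemma integral_cons_prod_weight_mul_prod_abs_sub_sq
    (hdeg : ∀ k, (p k).natDegree = k) (hmonic : ∀ k, (p k).Monic)
    (h_integrable : ∀ i j, Integrable fun t => (p i).eval t * (p j).eval t * w t)
    (horth : ∀ i j, ∫ t, (p i).eval t * (p j).eval t * w t = if i = j then h i else 0)
    (hh : ∀ k, h k ≠ 0) (n : ℕ) (x : ℝ) :
    ∫ t : Fin n → ℝ, (∏ l, w ((Fin.cons x t : Fin (n + 1) → ℝ) l)) *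
        ∏ j, ∏ k ∈ Finset.Ioi j,
          |(Fin.cons x t : Fin (n + 1) → ℝ) k - (Fin.cons x t : Fin (n + 1) → ℝ) j| ^ 2 =
      n.factorial * (∏ k ∈ range (n + 1), h k) *
        (w x * ∑ k ∈ range (n + 1), (p k).eval x ^ 2 / h k) := by
  have hI (σ τ : Equiv.Perm (Fin (n + 1))) : Integrable fun t : Fin n → ℝ =>
      ((Equiv.Perm.sign σ : ℤ) : ℝ) * ((Equiv.Perm.sign τ : ℤ) : ℝ) *
        ((p (σ 0)).eval x * (p (τ 0)).eval x * w x *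
          ∏ i : Fin n, ((p (σ i.succ)).eval (t i) * (p (τ i.succ)).eval (t i) * w (t i))) :=
    ((Integrable.fintype_prod
      (f := fun (i : Fin n) t => (p (σ i.succ)).eval t * (p (τ i.succ)).eval t * w t)
      fun i => h_integrable _ _).const_mul _).const_mul _
  simp_rw [prod_weight_mul_prod_abs_sub_sq_eq_sum hdeg hmonic, Fin.prod_univ_succ, Fin.cons_zero,
    Fin.cons_succ]
  rw [integral_finsetSum _ fun σ _ => integrable_finsetSum _ fun τ _ => hI σ τ]
  have hval (σ : Equiv.Perm (Fin (n + 1))) : ∫ t : Fin n → ℝ, ∑ τ : Equiv.Perm (Fin (n + 1)),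
      ((Equiv.Perm.sign σ : ℤ) : ℝ) * ((Equiv.Perm.sign τ : ℤ) : ℝ) *
        ((p (σ 0)).eval x * (p (τ 0)).eval x * w x *
          ∏ i : Fin n, ((p (σ i.succ)).eval (t i) * (p (τ i.succ)).eval (t i) * w (t i))) =
      (∏ k ∈ range (n + 1), h k) * (w x * ((p (σ 0)).eval x ^ 2 / h (σ 0))) := by
    rw [integral_finsetSum _ fun τ _ => hI σ τ, Finset.sum_eq_single σ]
    · rw [sign_mul_sign_self]
      simp_rw [one_mul]
      rw [integral_const_mul, integral_fintype_prod_volume_eq_prod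
          (fun (i : Fin n) t => (p (σ i.succ)).eval t * (p (σ i.succ)).eval t * w t)]
      simp_rw [horth, if_true]
      -- The variable at index 0 is not integrated, so the product of norms lacks the factor h (σ
      -- 0); this produces the division.
      have := Equiv.prod_comp σ (fun i : Fin (n + 1) => h i)
      rw [Fin.prod_univ_succ] at this
      rw [Finset.prod_range, ← this]
      field_simp [hh (σ 0)]
    · intro τ _ hτ
      -- Permutations that agree off 0 agree at 0 too, so distinct ones already differ at an
      -- integrated variable.
      obtain ⟨i, hi⟩ : ∃ i : Fin n, σ i.succ ≠ τ i.succ := by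
        by_contra! hc
        refine hτ (Equiv.ext fun i => ?_)
        have hrest (j : Fin (n + 1)) (hj : j ≠ 0) : τ j = σ j := by
          obtain ⟨k, rfl⟩ := Fin.exists_succ_eq.2 hj
          exact (hc k).symm
        by_cases hi : i = 0
        · subst hi
          by_contra hne
          set j := σ.symm (τ 0) with hj
          have hσj : σ j = τ 0 := by simp [hj]
          have hj0 : j ≠ 0 := fun h0 => hne (by rw [← hσj, h0])
          have := hrest j hj0
          exact hj0 (τ.injective (this.trans hσj))
        · exact hrest i hi
      rw [integral_const_mul, integral_const_mul, integral_fintype_prod_volume_eq_prod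
          (fun (i : Fin n) t => (p (σ i.succ)).eval t * (p (τ i.succ)).eval t * w t),
        Finset.prod_eq_zero (Finset.mem_univ i), mul_zero, mul_zero]
      rw [horth, if_neg]
      exact fun hc => hi (Fin.ext hc)
    · simp
  simp_rw [hval]
  rw [← Finset.mul_sum, ← Finset.mul_sum,
    sum_perm_apply_zero (fun k : Fin (n + 1) => (p k).eval x ^ 2 / h k),
    Finset.sum_range (fun k => (p k).eval x ^ 2 / h k)]
  ring

end OrthogonalPolynomials

/-! ### Monic Laguerre polynomials -/

/-- The monic Laguerre polynomial `(-1) ^ n n! L_n^{(α)}`. -/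
def laguerre (α : ℝ) (n : ℕ) : ℝ[X] :=
  ∑ j ∈ range (n + 1), monomial j
    ((-1) ^ (n + j) * (n.choose j : ℝ) * (Real.Gamma (n + α + 1) / Real.Gamma (j + α + 1)))

lemma coeff_laguerre (α : ℝ) (n j : ℕ) :
    (laguerre α n).coeff j =
      (-1) ^ (n + j) * (n.choose j : ℝ) * (Real.Gamma (n + α + 1) / Real.Gamma (j + α + 1)) := by
  simp only [laguerre, finsetSum_coeff, coeff_monomial]
  rw [Finset.sum_ite_eq']
  split_ifs with hj
  · rfl
  · rw [Nat.choose_eq_zero_of_lt (by simpa using hj)]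
    simp

lemma Gamma_natCast_add_pos {α : ℝ} (hα : -1 < α) (n : ℕ) : 0 < Real.Gamma (n + α + 1) :=
  Real.Gamma_pos_of_pos (by have : (0 : ℝ) ≤ n := n.cast_nonneg; linarith)

lemma Gamma_natCast_succ_add {α : ℝ} (hα : -1 < α) (n : ℕ) :
    Real.Gamma ((n + 1 : ℕ) + α + 1) = (n + α + 1) * Real.Gamma (n + α + 1) := by
  have : (0 : ℝ) ≤ n := n.cast_nonneg
  rw [← Real.Gamma_add_one (by linarith)]
  push_cast
  ring_nf

lemma natDegree_laguerre {α : ℝ} (hα : -1 < α) (n : ℕ) : (laguerre α n).natDegree = n := by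
  refine natDegree_eq_of_le_of_coeff_ne_zero ?_ ?_
  · refine natDegree_le_iff_coeff_eq_zero.2 fun j hj => ?_
    rw [coeff_laguerre, Nat.choose_eq_zero_of_lt hj]
    simp
  · rw [coeff_laguerre, div_self (Gamma_natCast_add_pos hα n).ne']
    simp

lemma monic_laguerre {α : ℝ} (hα : -1 < α) (n : ℕ) : (laguerre α n).Monic := by
  rw [Monic, leadingCoeff, natDegree_laguerre hα, coeff_laguerre,
    div_self (Gamma_natCast_add_pos hα n).ne', ← two_mul, pow_mul]
  simp

/-! ### Moments of the weight and orthogonality -/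

lemma pow_mul_weight (a : ℝ) (k : ℕ) :
    (fun t => t ^ k * weight a t) =
      (Set.Ioi (0 : ℝ)).indicator fun t => Real.exp (-t) * t ^ ((k + a + 1 : ℝ) - 1) := by
  funext t
  unfold weight
  by_cases ht : t ∈ Set.Ioi (0 : ℝ)
  · rw [Set.indicator_of_mem ht, Set.indicator_of_mem ht, add_sub_cancel_right,
      Real.rpow_add ht, Real.rpow_natCast]
    ring
  · simp [Set.indicator_of_notMem ht]

lemma integrable_pow_mul_weight {a : ℝ} (ha : -1 < a) (k : ℕ) :
    Integrable fun t => t ^ k * weight a t := by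
  have : (0 : ℝ) ≤ k := k.cast_nonneg
  rw [pow_mul_weight, integrable_indicator_iff measurableSet_Ioi]
  exact Real.GammaIntegral_convergent (by linarith)

lemma integral_pow_mul_weight {a : ℝ} (ha : -1 < a) (k : ℕ) :
    ∫ t, t ^ k * weight a t = Real.Gamma (k + a + 1) := by
  have : (0 : ℝ) ≤ k := k.cast_nonneg
  rw [pow_mul_weight, integral_indicator measurableSet_Ioi,
    Real.Gamma_eq_integral (by linarith)]

lemma integrable_eval_mul_weight {a : ℝ} (ha : -1 < a) (p : ℝ[X]) :
    Integrable fun t => p.eval t * weight a t := by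
  simp_rw [eval_eq_sum_range, Finset.sum_mul, mul_assoc]
  exact integrable_finsetSum _ fun i _ => (integrable_pow_mul_weight ha i).const_mul _

lemma Gamma_add_natCast_eq_ascPochhammer {s : ℝ} (hs : 0 < s) (k : ℕ) :
    Real.Gamma (s + k) = (ascPochhammer ℝ k).eval s * Real.Gamma s := by
  induction k with
  | zero => simp
  | succ k ih =>
    have : (0 : ℝ) ≤ k := k.cast_nonneg
    rw [ascPochhammer_succ_eval, Nat.cast_succ, ← add_assoc, Real.Gamma_add_one (by linarith), ih]
    ring

/-- The moment Γ(m + j + a + 1) is (j + a + 1)_m Γ(j + a + 1), and the last factor cancels the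
denominator of the jth coefficient. What remains is the nth finite difference at a + 1 of a monic
polynomial of degree m: zero for m < n and n! for m = n. -/
lemma integral_pow_mul_laguerre {a : ℝ} (ha : -1 < a) {m n : ℕ} (hmn : m ≤ n) :
    ∫ t, t ^ m * (laguerre a n).eval t * weight a t =
      if m = n then n.factorial * Real.Gamma (n + a + 1) else 0 := by
  have hsum : ∫ t, t ^ m * (laguerre a n).eval t * weight a t =
      ∑ j ∈ range (n + 1), (laguerre a n).coeff j * Real.Gamma ((m + j : ℕ) + a + 1) := by
    have hpt (t : ℝ) : t ^ m * (laguerre a n).eval t * weight a t =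
        ∑ j ∈ range (n + 1), (laguerre a n).coeff j * (t ^ (m + j) * weight a t) := by
      rw [eval_eq_sum_range, natDegree_laguerre ha, Finset.mul_sum, Finset.sum_mul]
      exact Finset.sum_congr rfl fun j _ => by ring
    simp_rw [hpt]
    rw [integral_finsetSum _ fun j _ => (integrable_pow_mul_weight ha _).const_mul _]
    exact Finset.sum_congr rfl fun j _ => by
      rw [integral_const_mul, integral_pow_mul_weight ha]
  have hdiff : ∑ j ∈ range (n + 1),
      (laguerre a n).coeff j * Real.Gamma ((m + j : ℕ) + a + 1) =
      Real.Gamma (n + a + 1) * (fwdDiff 1)^[n] (ascPochhammer ℝ m).eval (a + 1) := by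
    rw [fwdDiff_iter_eq_sum_shift, Finset.mul_sum]
    refine Finset.sum_congr rfl fun j hj => ?_
    have hjn : j ≤ n := Nat.lt_succ_iff.1 (Finset.mem_range.1 hj)
    have hG := Gamma_natCast_add_pos ha j
    have h1 : ((m + j : ℕ) : ℝ) + a + 1 = (j + a + 1) + m := by push_cast; ring
    have h2 : a + 1 + j • (1 : ℝ) = j + a + 1 := by rw [nsmul_eq_mul]; ring
    have h3 : (-1 : ℝ) ^ (n + j) = (-1) ^ (n - j) := by
      conv_lhs => rw [← Nat.sub_add_cancel hjn]
      rw [add_assoc, pow_add, ← two_mul, pow_mul]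
      simp
    rw [coeff_laguerre, h1, h2, Gamma_add_natCast_eq_ascPochhammer
      (by have : (0 : ℝ) ≤ j := j.cast_nonneg; linarith), h3, zsmul_eq_mul]
    push_cast
    field_simp
  rw [hsum, hdiff]
  have hdeg : (ascPochhammer ℝ m).natDegree = m := ascPochhammer_natDegree ℝ m
  split_ifs with h
  · subst h
    have := congrFun (Polynomial.fwdDiff_iter_degree_eq_factorial (ascPochhammer ℝ m)) (a + 1)
    rw [hdeg] at this
    rw [this, (monic_ascPochhammer ℝ m).leadingCoeff]
    simp [mul_comm]
  · rw [Polynomial.fwdDiff_iter_eq_zero_of_degree_lt (by rw [hdeg]; omega)]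
    simp

lemma integral_laguerre_mul_laguerre_of_le {a : ℝ} (ha : -1 < a) {m n : ℕ} (hmn : m ≤ n) :
    ∫ t, (laguerre a m).eval t * (laguerre a n).eval t * weight a t =
      if m = n then n.factorial * Real.Gamma (n + a + 1) else 0 := by
  have hpt (t : ℝ) : (laguerre a m).eval t * (laguerre a n).eval t * weight a t =
      ∑ j ∈ range (m + 1),
        (laguerre a m).coeff j * (t ^ j * (laguerre a n).eval t * weight a t) := by
    rw [eval_eq_sum_range (p := laguerre a m), natDegree_laguerre ha, Finset.sum_mul,
      Finset.sum_mul]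
    exact Finset.sum_congr rfl fun j _ => by ring
  simp_rw [hpt]
  rw [integral_finsetSum]
  · simp_rw [integral_const_mul]
    rw [Finset.sum_range_succ, Finset.sum_eq_zero, integral_pow_mul_laguerre ha hmn, zero_add]
    · have := (monic_laguerre ha m).coeff_natDegree
      rw [natDegree_laguerre ha] at this
      rw [this, one_mul]
    · intro j hj
      have := Finset.mem_range.1 hj
      rw [integral_pow_mul_laguerre ha (by omega), if_neg (by omega), mul_zero]
  · intro j _
    have := integrable_eval_mul_weight ha (X ^ j * laguerre a n)
    simp only [eval_mul, eval_pow, eval_X] at this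
    exact this.const_mul _

lemma integral_laguerre_mul_laguerre {a : ℝ} (ha : -1 < a) (m n : ℕ) :
    ∫ t, (laguerre a m).eval t * (laguerre a n).eval t * weight a t =
      if m = n then m.factorial * Real.Gamma (m + a + 1) else 0 := by
  rcases le_total m n with h | h
  · rw [integral_laguerre_mul_laguerre_of_le ha h]
    split_ifs with hmn
    · rw [hmn]
    · rfl
  · simp_rw [mul_comm ((laguerre a m).eval _)]
    rw [integral_laguerre_mul_laguerre_of_le ha h]
    simp [eq_comm]

/-- The density of the Laguerre unitary ensemble as a sum over orthogonal polynomials. -/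
lemma density_succ_eq {a : ℝ} (ha : -1 < a) (n : ℕ) (x : ℝ) :
    density a (n + 1) x = weight a x * ∑ k ∈ range (n + 1),
      (laguerre a k).eval x ^ 2 / (k.factorial * Real.Gamma (k + a + 1)) := by
  have hne (k : ℕ) : (k.factorial : ℝ) * Real.Gamma (k + a + 1) ≠ 0 :=
    mul_ne_zero (Nat.cast_ne_zero.2 k.factorial_ne_zero) (Gamma_natCast_add_pos ha k).ne'
  have h_integrable (i j : ℕ) :
      Integrable fun t => (laguerre a i).eval t * (laguerre a j).eval t * weight a t := by
    simpa only [eval_mul] using integrable_eval_mul_weight ha (laguerre a i * laguerre a j)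
  have hZ := integral_prod_weight_mul_prod_abs_sub_sq (w := weight a) (natDegree_laguerre ha)
    (monic_laguerre ha) h_integrable (integral_laguerre_mul_laguerre ha) (n + 1)
  have hM := integral_cons_prod_weight_mul_prod_abs_sub_sq (w := weight a) (natDegree_laguerre ha)
    (monic_laguerre ha) h_integrable (integral_laguerre_mul_laguerre ha) hne n x
  have hprod := Finset.prod_ne_zero_iff.2 fun k (_ : k ∈ range (n + 1)) => hne k
  have hfac : (n.factorial : ℝ) ≠ 0 := Nat.cast_ne_zero.2 n.factorial_ne_zero
  have hn : ((n + 1 : ℕ) : ℝ) ≠ 0 := Nat.cast_ne_zero.2 n.succ_ne_zero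
  simp only [density, partitionFunction, jointWeight]
  rw [hZ, hM, Nat.factorial_succ, Nat.cast_mul]
  field_simp

/-! ### Contiguous relations -/

lemma choose_succ_mul (n j : ℕ) :
    ((n + 1).choose j : ℝ) * (n + 1 - j) = (n + 1) * (n.choose j : ℝ) := by
  rcases le_or_gt j (n + 1) with h | h
  · have := Nat.choose_mul_succ_eq n j
    rw [← Nat.cast_succ, ← Nat.cast_sub h]
    exact_mod_cast this.symm.trans (mul_comm _ _)
  · rw [Nat.choose_eq_zero_of_lt h, Nat.choose_eq_zero_of_lt (by omega)]
    simp

lemma choose_add_one_mul (n j : ℕ) :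
    (n.choose (j + 1) : ℝ) * (j + 1) = n.choose j * (n - j) := by
  have h1 : ((n + 1).choose (j + 1) : ℝ) * (j + 1) = (n + 1) * n.choose j := by
    exact_mod_cast (Nat.add_one_mul_choose_eq n j).symm
  have h2 : ((n + 1).choose (j + 1) : ℝ) = n.choose j + n.choose (j + 1) := by
    exact_mod_cast Nat.choose_succ_succ n j
  rw [h2] at h1
  linarith

/-- With `X_mul_derivative_laguerre_succ` this carries the pair (g, x g') from degree n to n + 1,
and `laguerre_sub_one_succ` lowers the parameter from a + 1 to a. These three relations drive the
induction in `sum_laguerre_sq`. -/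
lemma laguerre_succ {α : ℝ} (hα : -1 < α) (n : ℕ) :
    laguerre α (n + 1) =
      (X - C (n + 1 + α)) * laguerre α n - X * derivative (laguerre α n) := by
  have hG := Gamma_natCast_succ_add hα n
  ext j
  cases j with
  | zero =>
    rw [sub_mul]
    simp only [coeff_sub, mul_coeff_zero, coeff_X_zero, coeff_laguerre, hG]
    simp
    ring
  | succ j =>
    have h1 := Gamma_natCast_succ_add hα j
    have h2 := (Gamma_natCast_add_pos hα j).ne'
    have h3 : (j : ℝ) + α + 1 ≠ 0 := by have : (0 : ℝ) ≤ j := j.cast_nonneg; linarith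
    have hc : ((n + 1).choose (j + 1) : ℝ) = n.choose j + n.choose (j + 1) := by
      exact_mod_cast Nat.choose_succ_succ n j
    have hc2 := choose_add_one_mul n j
    rw [sub_mul]
    simp only [coeff_sub, coeff_C_mul, coeff_X_mul, coeff_derivative, coeff_laguerre, hG, h1, hc]
    have hK : Real.Gamma (n + α + 1) / Real.Gamma (j + α + 1) = (j + α + 1) *
        (Real.Gamma (n + α + 1) / ((j + α + 1) * Real.Gamma (j + α + 1))) := by field_simp
    rw [hK]
    linear_combination -(-1) ^ (n + j) *
      (Real.Gamma (n + α + 1) / ((j + α + 1) * Real.Gamma (j + α + 1))) * hc2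

lemma X_mul_derivative_laguerre_succ {α : ℝ} (hα : -1 < α) (n : ℕ) :
    X * derivative (laguerre α (n + 1)) =
      C (n + 1 : ℝ) * laguerre α (n + 1) + C ((n + 1) * (n + 1 + α)) * laguerre α n := by
  have hG := Gamma_natCast_succ_add hα n
  ext j
  have hc := choose_succ_mul n j
  have hl : (X * derivative (laguerre α (n + 1))).coeff j = j * (laguerre α (n + 1)).coeff j := by
    cases j with
    | zero => simp
    | succ j => rw [coeff_X_mul, coeff_derivative]; push_cast; ring
  rw [hl]
  simp only [coeff_add, coeff_C_mul, coeff_laguerre, hG]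
  linear_combination (-1) ^ (n + j) * (n + α + 1) * Real.Gamma (n + α + 1) /
    Real.Gamma (j + α + 1) * hc

lemma laguerre_sub_one_succ {α : ℝ} (hα : 0 < α) (n : ℕ) :
    laguerre (α - 1) (n + 1) = laguerre α (n + 1) + C (n + 1 : ℝ) * laguerre α n := by
  have hG := Gamma_natCast_succ_add (show -1 < α by linarith) n
  ext j
  have hc := choose_succ_mul n j
  have hj : (0 : ℝ) ≤ j := j.cast_nonneg
  have hGj : Real.Gamma (j + α + 1) = (j + α) * Real.Gamma (j + α) :=
    Real.Gamma_add_one (by positivity)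
  have hne : Real.Gamma (j + α) ≠ 0 := (Real.Gamma_pos_of_pos (by positivity)).ne'
  have hne' : (j : ℝ) + α ≠ 0 := by positivity
  have e1 : ((n + 1 : ℕ) : ℝ) + (α - 1) + 1 = n + α + 1 := by push_cast; ring
  have e2 : (j : ℝ) + (α - 1) + 1 = j + α := by ring
  simp only [coeff_add, coeff_C_mul, coeff_laguerre, hG, e1, e2, hGj]
  have hK : Real.Gamma (n + α + 1) / Real.Gamma (j + α) = (j + α) *
      (Real.Gamma (n + α + 1) / ((j + α) * Real.Gamma (j + α))) := by field_simp
  rw [hK]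
  linear_combination (-1) ^ (n + j) *
    (Real.Gamma (n + α + 1) / ((j + α) * Real.Gamma (j + α))) * hc

/-- The Christoffel–Darboux sum in terms of a single Laguerre polynomial of parameter `a + 1`. -/
lemma sum_laguerre_sq {a : ℝ} (ha : -1 < a) (n : ℕ) (x : ℝ) :
    ∑ k ∈ range (n + 1), (laguerre a k).eval x ^ 2 / (k.factorial * Real.Gamma (k + a + 1)) =
      ((a + 1 + n * x) * (laguerre (a + 1) n).eval x ^ 2 +
        (2 + a - x) * (laguerre (a + 1) n).eval x *
          (x * (derivative (laguerre (a + 1) n)).eval x) +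
        (x * (derivative (laguerre (a + 1) n)).eval x) ^ 2) /
        (n.factorial * Real.Gamma (n + (a + 1) + 1)) := by
  have ha1 : -1 < a + 1 := by linarith
  induction n with
  | zero =>
    have h1 : laguerre (a + 1) 0 = 1 := by
      exact (monic_laguerre ha1 0).natDegree_eq_zero.1 (natDegree_laguerre ha1 0)
    have h2 : laguerre a 0 = 1 := by
      exact (monic_laguerre ha 0).natDegree_eq_zero.1 (natDegree_laguerre ha 0)
    have h3 := Real.Gamma_add_one (show a + 1 ≠ 0 by linarith)
    have h4 : Real.Gamma (a + 1) ≠ 0 := (Real.Gamma_pos_of_pos (by linarith)).ne'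
    have h5 : a + 1 ≠ 0 := by linarith
    simp [h1, h2, h3]
    field_simp
  | succ n ih =>
    have hn : (0 : ℝ) ≤ n := n.cast_nonneg
    have e1 : (laguerre (a + 1) (n + 1)).eval x = (x - (n + 1 + (a + 1))) *
        (laguerre (a + 1) n).eval x - x * (derivative (laguerre (a + 1) n)).eval x := by
      rw [laguerre_succ ha1]; simp
    have e2 : x * (derivative (laguerre (a + 1) (n + 1))).eval x =
        (n + 1) * (laguerre (a + 1) (n + 1)).eval x +
          (n + 1) * (n + 1 + (a + 1)) * (laguerre (a + 1) n).eval x := by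
      have := congrArg (eval x) (X_mul_derivative_laguerre_succ ha1 n)
      simpa using this
    have e3 : (laguerre a (n + 1)).eval x =
        (laguerre (a + 1) (n + 1)).eval x + (n + 1) * (laguerre (a + 1) n).eval x := by
      have := congrArg (eval x) (laguerre_sub_one_succ (show 0 < a + 1 by linarith) n)
      simpa using this
    have hG := Gamma_natCast_succ_add ha1 n
    have hG' : ((n + 1 : ℕ) : ℝ) + a + 1 = n + (a + 1) + 1 := by push_cast; ring
    have hne := (Gamma_natCast_add_pos ha1 n).ne'
    have hf : (n.factorial : ℝ) ≠ 0 := Nat.cast_ne_zero.2 n.factorial_ne_zero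
    have hn1 : (n : ℝ) + 1 ≠ 0 := by positivity
    have hn2 : (n : ℝ) + (a + 1) + 1 ≠ 0 := by linarith
    rw [Finset.sum_range_succ, ih, hG, hG', e2, e3, e1, Nat.factorial_succ]
    -- All terms are now quadratic in g and d = x g' of degree n, so the inductive step is a
    -- rational identity.
    generalize x * (derivative (laguerre (a + 1) n)).eval x = d
    generalize (laguerre (a + 1) n).eval x = g
    push_cast
    field_simp
    ring

/-! ### Power series of the Laguerre functions -/

/-- The power series of `exp (-X / 2)`. -/
def expNegHalf : PowerSeries ℝ := PowerSeries.rescale (-1 / 2 : ℝ) (PowerSeries.exp ℝ)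

lemma coeff_expNegHalf (m : ℕ) :
    PowerSeries.coeff m expNegHalf = (-1 / 2 : ℝ) ^ m / m.factorial := by
  simp [expNegHalf, PowerSeries.coeff_rescale, PowerSeries.coeff_exp, div_eq_mul_inv]

lemma derivative_expNegHalf :
    PowerSeries.derivative ℝ expNegHalf = PowerSeries.C (-1 / 2 : ℝ) * expNegHalf := by
  ext m
  rw [PowerSeries.coeff_derivative, PowerSeries.coeff_C_mul, coeff_expNegHalf, coeff_expNegHalf,
    Nat.factorial_succ]
  have hf : (m.factorial : ℝ) ≠ 0 := Nat.cast_ne_zero.2 m.factorial_ne_zero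
  have hm : (m : ℝ) + 1 ≠ 0 := by positivity
  push_cast
  field_simp
  ring

lemma hasSum_coeff_expNegHalf_mul (p : ℝ[X]) (x : ℝ) :
    HasSum (fun m => PowerSeries.coeff m (expNegHalf * (p : PowerSeries ℝ)) * x ^ m)
      (Real.exp (-x / 2) * p.eval x) := by
  have hE : HasSum (fun m => PowerSeries.coeff m expNegHalf * x ^ m) (Real.exp (-x / 2)) := by
    have := NormedSpace.expSeries_div_hasSum_exp (-x / 2 : ℝ)
    rw [← Real.exp_eq_exp_ℝ] at this
    have hfun : (fun m => PowerSeries.coeff m expNegHalf * x ^ m) =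
        fun m => (-x / 2) ^ m / (m.factorial : ℝ) := by
      funext m
      rw [coeff_expNegHalf, show -x / 2 = -1 / 2 * x by ring, mul_pow]
      ring
    rw [hfun]
    exact this
  have hEn : Summable fun m => ‖PowerSeries.coeff m expNegHalf * x ^ m‖ := hE.summable.norm
  have hP : HasSum (fun m => p.coeff m * x ^ m) (p.eval x) := by
    rw [eval_eq_sum_range]
    refine hasSum_sum_of_ne_finset_zero fun m hm => ?_
    rw [coeff_eq_zero_of_natDegree_lt (by simpa using hm), zero_mul]
  have hPn : Summable fun m => ‖p.coeff m * x ^ m‖ := hP.summable.norm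
  have hterm (m : ℕ) : PowerSeries.coeff m (expNegHalf * (p : PowerSeries ℝ)) * x ^ m =
      ∑ kl ∈ HasAntidiagonal.antidiagonal m, PowerSeries.coeff kl.1 expNegHalf * x ^ kl.1 *
        (p.coeff kl.2 * x ^ kl.2) := by
    rw [PowerSeries.coeff_mul, Finset.sum_mul]
    refine Finset.sum_congr rfl fun kl hkl => ?_
    rw [← HasAntidiagonal.mem_antidiagonal.1 hkl, pow_add, Polynomial.coeff_coe]
    ring
  simp_rw [hterm]
  rw [← hE.tsum_eq, ← hP.tsum_eq,
    tsum_mul_tsum_eq_tsum_sum_antidiagonal_of_summable_norm hEn hPn]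
  exact (summable_norm_sum_mul_antidiagonal_of_summable_norm hEn hPn).of_norm.hasSum

/-- The power series of `exp (-X / 2)` times the monic Laguerre polynomial. -/
def laguerreSeries (α : ℝ) (n : ℕ) : PowerSeries ℝ :=
  expNegHalf * (laguerre α n : PowerSeries ℝ)

lemma laguerre_coeff_succ {α : ℝ} (hα : -1 < α) (n j : ℕ) :
    (j + 1) * (j + α + 1) * (laguerre α n).coeff (j + 1) =
      ((j : ℝ) - n) * (laguerre α n).coeff j := by
  have h1 := Gamma_natCast_succ_add hα j
  have h2 := (Gamma_natCast_add_pos hα j).ne'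
  have h3 : (j : ℝ) + α + 1 ≠ 0 := by have : (0 : ℝ) ≤ j := j.cast_nonneg; linarith
  have hc := choose_add_one_mul n j
  rw [coeff_laguerre, coeff_laguerre, h1]
  field_simp
  linear_combination (-1) ^ (n + (j + 1)) * Real.Gamma (n + α + 1) * hc

lemma laguerre_differential_equation {α : ℝ} (hα : -1 < α) (n : ℕ) :
    X * derivative (derivative (laguerre α n)) + (C (α + 1) - X) * derivative (laguerre α n) +
      C (n : ℝ) * laguerre α n = 0 := by
  ext j
  have h := laguerre_coeff_succ hα n j
  rw [sub_mul]
  generalize hβ : α + 1 = β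
  obtain rfl : α = β - 1 := by linarith
  cases j with
  | zero =>
    simp [coeff_derivative] at h ⊢
    linarith
  | succ j =>
    simp [coeff_derivative] at h ⊢
    linarith

lemma derivative_laguerreSeries (α : ℝ) (n : ℕ) :
    PowerSeries.derivative ℝ (laguerreSeries α n) =
      expNegHalf * ((derivative (laguerre α n) - C (1 / 2) * laguerre α n : ℝ[X]) :
        PowerSeries ℝ) := by
  rw [laguerreSeries, Derivation.leibniz, derivative_expNegHalf, PowerSeries.derivative_coe]
  simp only [smul_eq_mul, Polynomial.coe_sub, Polynomial.coe_mul, Polynomial.coe_C]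
  have : PowerSeries.C (-1 / 2 : ℝ) = - PowerSeries.C (1 / 2 : ℝ) := by
    rw [← map_neg]; norm_num
  rw [this]
  ring

/-- The factor exp(-x/2) removes the term -x f' of Laguerre's equation. The constant n + (α + 1)/2
that appears is the shifted size, which singles it out as the natural expansion parameter. -/
lemma laguerreSeries_differential_equation {α : ℝ} (hα : -1 < α) (n : ℕ) :
    PowerSeries.X * PowerSeries.derivative ℝ (PowerSeries.derivative ℝ (laguerreSeries α n)) +
      PowerSeries.C (α + 1) * PowerSeries.derivative ℝ (laguerreSeries α n) +
      (PowerSeries.C (n + (α + 1) / 2) - PowerSeries.X * PowerSeries.C (1 / 4)) *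
        laguerreSeries α n = 0 := by
  have hode := congrArg (fun p : ℝ[X] => (p : PowerSeries ℝ)) (laguerre_differential_equation hα n)
  simp only [Polynomial.coe_add, Polynomial.coe_mul, Polynomial.coe_sub, Polynomial.coe_X,
    Polynomial.coe_C, Polynomial.coe_zero] at hode
  rw [derivative_laguerreSeries, Derivation.leibniz, derivative_expNegHalf,
    PowerSeries.derivative_coe, laguerreSeries]
  simp only [smul_eq_mul, Polynomial.coe_sub, Polynomial.coe_mul, Polynomial.coe_C, derivative_sub,
    derivative_mul, derivative_C, zero_mul, zero_add]
  have c1 : PowerSeries.C (-1 / 2 : ℝ) = - PowerSeries.C (1 / 2 : ℝ) := by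
    rw [← map_neg]; norm_num
  have c2 : PowerSeries.C (n + (α + 1) / 2 : ℝ) =
      PowerSeries.C (n : ℝ) + PowerSeries.C (α + 1) * PowerSeries.C (1 / 2 : ℝ) := by
    rw [← map_mul, ← map_add]; congr 1; ring
  have c3 : PowerSeries.C (1 / 4 : ℝ) = PowerSeries.C (1 / 2 : ℝ) * PowerSeries.C (1 / 2 : ℝ) := by
    rw [← map_mul]; norm_num
  have c4 : PowerSeries.C (1 / 2 : ℝ) + PowerSeries.C (1 / 2 : ℝ) = 1 := by
    rw [← map_add]; norm_num
  rw [c1, c2, c3]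
  linear_combination expNegHalf * hode -
    expNegHalf * PowerSeries.X * (derivative (laguerre α n) : ℝ[X]) * c4

lemma laguerreSeries_coeff_zero (α : ℝ) (n : ℕ) :
    PowerSeries.coeff 0 (laguerreSeries α n) =
      (-1) ^ n * (Real.Gamma (n + α + 1) / Real.Gamma (α + 1)) := by
  have h0 := coeff_expNegHalf 0
  rw [PowerSeries.coeff_zero_eq_constantCoeff] at h0
  simp [laguerreSeries, h0, coeff_laguerre]

lemma laguerreSeries_coeff_one {α : ℝ} (hα : -1 < α) (n : ℕ) :
    (α + 1) * PowerSeries.coeff 1 (laguerreSeries α n) =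
      -(n + (α + 1) / 2) * PowerSeries.coeff 0 (laguerreSeries α n) := by
  have h := congrArg (PowerSeries.coeff 0) (laguerreSeries_differential_equation hα n)
  generalize hκ : (n + (α + 1) / 2 : ℝ) = κ at h
  generalize hβ : α + 1 = β at h
  rw [sub_mul, mul_assoc PowerSeries.X] at h
  simp only [map_add, map_sub, PowerSeries.coeff_C_mul, PowerSeries.coeff_zero_X_mul,
    PowerSeries.coeff_derivative, map_zero] at h
  simp only [zero_add] at h
  push_cast at h
  linarith

lemma laguerreSeries_coeff_add_two {α : ℝ} (hα : -1 < α) (n m : ℕ) :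
    (m + 2) * (m + 2 + α) * PowerSeries.coeff (m + 2) (laguerreSeries α n) =
      -(n + (α + 1) / 2) * PowerSeries.coeff (m + 1) (laguerreSeries α n) +
        1 / 4 * PowerSeries.coeff m (laguerreSeries α n) := by
  have h := congrArg (PowerSeries.coeff (m + 1)) (laguerreSeries_differential_equation hα n)
  generalize hκ : (n + (α + 1) / 2 : ℝ) = κ at h
  generalize hβ : α + 1 = β at h
  rw [sub_mul, mul_assoc PowerSeries.X] at h
  simp only [map_add, map_sub, PowerSeries.coeff_C_mul, PowerSeries.coeff_succ_X_mul,
    PowerSeries.coeff_derivative, map_zero] at h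
  push_cast at h
  linear_combination h + (m + 2) * PowerSeries.coeff (m + 2) (laguerreSeries α n) * hβ

/-- The Taylor coefficients of the entire function `z ↦ (√z / 2) ^ (-ν) J_ν(√z)`. -/
def besselCoeff (ν : ℝ) (m : ℕ) : ℝ :=
  (-1 / 4) ^ m / ((m.factorial : ℝ) * Real.Gamma (m + ν + 1))

/-- The ratio between the Taylor coefficients of the scaled Laguerre function and those of the
Bessel function, where `ε` is the inverse square of the shifted size. -/
def finiteSizeFactor (α ε : ℝ) : ℕ → ℝ
  | 0 => 1
  | 1 => 1
  | m + 2 => finiteSizeFactor α ε (m + 1) +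
      ε * ((m + 1) * (m + 1 + α) / 4) * finiteSizeFactor α ε m

lemma besselCoeff_succ {ν : ℝ} (hν : -1 < ν) (m : ℕ) :
    besselCoeff ν m = -4 * ((m + 1) * (m + 1 + ν)) * besselCoeff ν (m + 1) := by
  have h1 := (Gamma_natCast_add_pos hν m).ne'
  have h2 : (m.factorial : ℝ) ≠ 0 := Nat.cast_ne_zero.2 m.factorial_ne_zero
  have h3 : (m : ℝ) + ν + 1 ≠ 0 := by have : (0 : ℝ) ≤ m := m.cast_nonneg; linarith
  have h4 : (m : ℝ) + 1 ≠ 0 := by positivity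
  rw [besselCoeff, besselCoeff, Gamma_natCast_succ_add hν, Nat.factorial_succ]
  push_cast
  field_simp
  ring

/-- Dividing the three-term recursion by the Bessel one (`besselCoeff_succ`) and scaling by (4κ)^m
leaves exactly the recursion that defines `finiteSizeFactor`, with ε = κ⁻². -/
lemma laguerreSeries_coeff {α : ℝ} (hα : -1 < α) (n m : ℕ) :
    PowerSeries.coeff m (laguerreSeries α n) =
      (-1) ^ n * Real.Gamma (n + α + 1) * (4 * (n + (α + 1) / 2)) ^ m *
        (besselCoeff α m * finiteSizeFactor α (1 / (n + (α + 1) / 2) ^ 2) m) := by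
  have hκ : (n + (α + 1) / 2 : ℝ) ≠ 0 := by
    have : (0 : ℝ) ≤ n := n.cast_nonneg
    have : 0 < (n + (α + 1) / 2 : ℝ) := by linarith
    exact this.ne'
  induction m using Nat.twoStepInduction with
  | zero =>
    rw [laguerreSeries_coeff_zero]
    simp [besselCoeff, finiteSizeFactor]
    ring
  | one =>
    have h := laguerreSeries_coeff_one hα n
    rw [laguerreSeries_coeff_zero] at h
    have h1 : α + 1 ≠ 0 := by linarith
    have h2 := besselCoeff_succ hα 0
    have h3 : besselCoeff α 0 = 1 / Real.Gamma (α + 1) := by simp [besselCoeff]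
    rw [h3] at h2
    apply mul_left_cancel₀ h1
    rw [h]
    simp only [finiteSizeFactor, zero_add, Nat.cast_zero] at h2 ⊢
    linear_combination -((n + (α + 1) / 2) * (-1) ^ n * Real.Gamma (n + α + 1)) * h2
  | more m ih0 ih1 =>
    have h := laguerreSeries_coeff_add_two hα n m
    have hm : (0 : ℝ) ≤ m := m.cast_nonneg
    have h1 : ((m : ℝ) + 2) * (m + 2 + α) ≠ 0 :=
      mul_ne_zero (by positivity) (by linarith)
    have hb0 := besselCoeff_succ hα m
    have hb1 := besselCoeff_succ hα (m + 1)
    apply mul_left_cancel₀ h1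
    rw [h, ih0, ih1]
    generalize hκ' : (n + (α + 1) / 2 : ℝ) = κ at hκ ⊢
    rw [hb0, hb1, finiteSizeFactor]
    generalize finiteSizeFactor α (1 / κ ^ 2) (m + 1) = t1
    generalize finiteSizeFactor α (1 / κ ^ 2) m = t0
    push_cast
    field_simp
    ring

/-- The scaled Laguerre function. -/
def scaledLaguerre (α ε y : ℝ) : ℝ := ∑' m : ℕ, besselCoeff α m * finiteSizeFactor α ε m * y ^ m

/-- The Euler operator applied to the scaled Laguerre function. -/
def eulerScaledLaguerre (α ε y : ℝ) : ℝ :=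
  ∑' m : ℕ, (m : ℝ) * (besselCoeff α m * finiteSizeFactor α ε m * y ^ m)

lemma exp_mul_laguerre {α : ℝ} (hα : -1 < α) (n : ℕ) (y : ℝ) {κ x : ℝ}
    (hκ : κ = n + (α + 1) / 2) (hx : 4 * κ * x = y) :
    Real.exp (-x / 2) * (laguerre α n).eval x =
      (-1) ^ n * Real.Gamma (n + α + 1) * scaledLaguerre α (1 / κ ^ 2) y := by
  have h := hasSum_coeff_expNegHalf_mul (laguerre α n) x
  rw [scaledLaguerre, ← h.tsum_eq, ← tsum_mul_left]
  refine tsum_congr fun m => ?_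
  have := laguerreSeries_coeff hα n m
  rw [laguerreSeries] at this
  rw [this, ← hκ, ← hx, mul_pow (4 * κ)]
  ring

/-- The left side is x f' for f = exp(-x/2) g. The Euler operator is unchanged by the scaling y =
4κx and multiplies the mth Taylor term by m. -/
lemma exp_mul_euler_laguerre {α : ℝ} (hα : -1 < α) (n : ℕ) (y : ℝ) {κ x : ℝ}
    (hκ : κ = n + (α + 1) / 2) (hx : 4 * κ * x = y) :
    Real.exp (-x / 2) * (x * (derivative (laguerre α n)).eval x -
        x / 2 * (laguerre α n).eval x) =
      (-1) ^ n * Real.Gamma (n + α + 1) * eulerScaledLaguerre α (1 / κ ^ 2) y := by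
  have h := (hasSum_coeff_expNegHalf_mul
    (derivative (laguerre α n) - C (1 / 2) * laguerre α n) x).mul_left x
  rw [← derivative_laguerreSeries] at h
  have h' : HasSum (fun m : ℕ => (m : ℝ) * (PowerSeries.coeff m (laguerreSeries α n) * x ^ m))
      (x * (Real.exp (-x / 2) *
        (derivative (laguerre α n) - C (1 / 2) * laguerre α n).eval x)) := by
    rw [← hasSum_nat_add_iff' 1]
    simp only [Finset.range_one, Finset.sum_singleton, Nat.cast_zero, zero_mul, sub_zero]
    have hfun : (fun m : ℕ => ((m + 1 : ℕ) : ℝ) *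
        (PowerSeries.coeff (m + 1) (laguerreSeries α n) * x ^ (m + 1))) = fun m =>
        x * (PowerSeries.coeff m (PowerSeries.derivative ℝ (laguerreSeries α n)) * x ^ m) := by
      funext m
      rw [PowerSeries.coeff_derivative]
      push_cast
      ring
    rw [hfun]
    exact h
  have hv : Real.exp (-x / 2) * (x * (derivative (laguerre α n)).eval x -
      x / 2 * (laguerre α n).eval x) = x * (Real.exp (-x / 2) *
        (derivative (laguerre α n) - C (1 / 2) * laguerre α n).eval x) := by
    simp only [eval_sub, eval_mul, eval_C]
    ring
  rw [hv, eulerScaledLaguerre, ← h'.tsum_eq, ← tsum_mul_left]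
  refine tsum_congr fun m => ?_
  rw [laguerreSeries_coeff hα n m, ← hκ, ← hx, mul_pow (4 * κ)]
  ring

/-- The exact hard edge density at finite size. -/
lemma hardEdgeDensity_succ_eq {a : ℝ} (ha : -1 < a) (n : ℕ) {y : ℝ} (hy : 0 < y) {κ : ℝ}
    (hκ : κ = shiftedSize a (n + 1)) :
    hardEdgeDensity a (n + 1) y =
      Real.Gamma (n + (a + 1) + 1) / (n.factorial * κ ^ (a + 1)) * (y ^ a / 4 ^ (a + 1) *
        ((a + 1 + y / 4 - 1 / κ ^ 2 * y ^ 2 / 64) * scaledLaguerre (a + 1) (1 / κ ^ 2) y ^ 2 +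
          (a + 2) * scaledLaguerre (a + 1) (1 / κ ^ 2) y *
            eulerScaledLaguerre (a + 1) (1 / κ ^ 2) y +
          eulerScaledLaguerre (a + 1) (1 / κ ^ 2) y ^ 2)) := by
  have ha1 : -1 < a + 1 := by linarith
  have hn : (0 : ℝ) ≤ n := n.cast_nonneg
  have hκ' : κ = n + ((a + 1) + 1) / 2 := by rw [hκ, shiftedSize]; push_cast; ring
  have hpos : 0 < κ := by rw [hκ']; linarith
  set x := y / (4 * κ) with hxdef
  have hx : 4 * κ * x = y := by rw [hxdef]; field_simp
  have hxpos : 0 < x := by positivity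
  have h1 := exp_mul_laguerre ha1 n y hκ' hx
  have h2 := exp_mul_euler_laguerre ha1 n y hκ' hx
  have hG := (Gamma_natCast_add_pos ha1 n).ne'
  have hf : (n.factorial : ℝ) ≠ 0 := Nat.cast_ne_zero.2 n.factorial_ne_zero
  rw [hardEdgeDensity, ← hκ, ← hxdef, density_succ_eq ha, sum_laguerre_sq ha, weight,
    Set.indicator_of_mem (Set.mem_Ioi.2 hxpos)]
  have hexp : Real.exp (-x) = Real.exp (-x / 2) * Real.exp (-x / 2) := by
    rw [← Real.exp_add]; congr 1; ring
  have hs : ((-1 : ℝ) ^ n) * (-1) ^ n = 1 := by rw [← mul_pow]; simp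
  have hxa : 1 / (4 * κ) * x ^ a = y ^ a / 4 ^ (a + 1) / κ ^ (a + 1) := by
    rw [hxdef, Real.div_rpow hy.le (by positivity), Real.mul_rpow (by norm_num) hpos.le,
      Real.rpow_add_one (by norm_num), Real.rpow_add_one hpos.ne']
    field_simp
  generalize (x * (derivative (laguerre (a + 1) n)).eval x) = d at h2 ⊢
  generalize (laguerre (a + 1) n).eval x = g at h1 h2 ⊢
  generalize scaledLaguerre (a + 1) (1 / κ ^ 2) y = F at h1 ⊢
  generalize eulerScaledLaguerre (a + 1) (1 / κ ^ 2) y = G at h2 ⊢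
  generalize Real.Gamma (n + (a + 1) + 1) = Γ₀ at h1 h2 hG ⊢
  -- Writing d = (d - x g/2) + x g/2 makes the cross coefficient the constant a + 2 and the
  -- coefficient of g² equal to a + 1 + κx - x²/4, so n enters only through κ.
  have hquad : Real.exp (-x) * ((a + 1 + n * x) * g ^ 2 + (2 + a - x) * g * d + d ^ 2) =
      Γ₀ ^ 2 * ((a + 1 + y / 4 - 1 / κ ^ 2 * y ^ 2 / 64) * F ^ 2 + (a + 2) * F * G + G ^ 2) := by
    have hy4 : y / 4 = κ * x := by rw [← hx]; ring
    have hy64 : 1 / κ ^ 2 * y ^ 2 / 64 = x ^ 2 / 4 := by rw [← hx]; field_simp; norm_num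
    have hFF : Γ₀ ^ 2 * F ^ 2 = Real.exp (-x) * g ^ 2 := by
      rw [hexp]; linear_combination (-(Γ₀ ^ 2 * F ^ 2)) * hs -
        (Real.exp (-x / 2) * g + (-1) ^ n * Γ₀ * F) * h1
    have hFG : Γ₀ ^ 2 * (F * G) = Real.exp (-x) * (g * (d - x / 2 * g)) := by
      rw [hexp]; linear_combination (-(Γ₀ ^ 2 * (F * G))) * hs -
        (Real.exp (-x / 2) * (d - x / 2 * g)) * h1 - ((-1) ^ n * Γ₀ * F) * h2
    have hGG : Γ₀ ^ 2 * G ^ 2 = Real.exp (-x) * (d - x / 2 * g) ^ 2 := by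
      rw [hexp]; linear_combination (-(Γ₀ ^ 2 * G ^ 2)) * hs -
        (Real.exp (-x / 2) * (d - x / 2 * g) + (-1) ^ n * Γ₀ * G) * h2
    rw [hy4, hy64]
    have hna : (n : ℝ) = κ - (a + 2) / 2 := by rw [hκ']; ring
    rw [hna]
    linear_combination -(a + 1 + κ * x - x ^ 2 / 4) * hFF - (a + 2) * hFG - hGG
  calc 1 / (4 * κ) * (x ^ a * Real.exp (-x) *
        (((a + 1 + n * x) * g ^ 2 + (2 + a - x) * g * d + d ^ 2) / (n.factorial * Γ₀)))
      = (1 / (4 * κ) * x ^ a) * (Real.exp (-x) *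
          ((a + 1 + n * x) * g ^ 2 + (2 + a - x) * g * d + d ^ 2)) / (n.factorial * Γ₀) := by ring
    _ = _ := by
      rw [hxa, hquad]
      have : κ ^ (a + 1) ≠ 0 := (Real.rpow_pos_of_pos hpos _).ne'
      field_simp

end

section

open Finset Topology

/-! ### Expansion of the finite size factors -/

/-- The coefficient of `ε` in the finite size factor. -/
def factorOne (α k : ℝ) : ℝ := k * (k - 1) * (2 * k - 1 + 3 * α) / 24

/-- The coefficient of `ε ^ 2` in the finite size factor. -/
def factorTwo (α k : ℝ) : ℝ :=
  (-7 / 960 + α / 16 - 3 * α ^ 2 / 64) * k + (73 / 1152 - 17 * α / 96 + 11 * α ^ 2 / 128) * k ^ 2 +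
    (-23 / 192 + 17 * α / 96 - 3 * α ^ 2 / 64) * k ^ 3 +
    (103 / 1152 - 7 * α / 96 + α ^ 2 / 128) * k ^ 4 + (-7 / 240 + α / 96) * k ^ 5 + k ^ 6 / 288

/-- Comparing powers of ε in the recursion of `finiteSizeFactor` gives this equation and
`factorTwo_add_two`. The polynomials `factorOne` and `factorTwo` are their solutions vanishing at 0
and 1. -/
lemma factorOne_add_two (α m : ℝ) :
    factorOne α (m + 2) = factorOne α (m + 1) + (m + 1) * (m + 1 + α) / 4 := by
  unfold factorOne; ring

lemma factorTwo_add_two (α m : ℝ) :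
    factorTwo α (m + 2) = factorTwo α (m + 1) + (m + 1) * (m + 1 + α) / 4 * factorOne α m := by
  unfold factorOne factorTwo; ring

lemma factor_step_nonneg {α : ℝ} (hα : -1 < α) (m : ℕ) :
    0 ≤ ((m : ℝ) + 1) * (m + 1 + α) / 4 := by
  have : (0 : ℝ) ≤ m := m.cast_nonneg
  have : (0 : ℝ) ≤ m + 1 + α := by linarith
  positivity

/-- Comparison principle for solutions of the recursion of the finite size factors with source
terms. -/
lemma nonneg_and_le_mul_of_recursion {q u v T : ℕ → ℝ} {ε C : ℝ} (hε : 0 ≤ ε)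
    (hq : ∀ m, 0 ≤ q m)
    (hu : ∀ m, u (m + 2) = u (m + 1) + ε * q m * v m)
    (hT : ∀ m, T (m + 2) = T (m + 1) + q m * T m)
    (hv : ∀ m, 0 ≤ v m ∧ v m ≤ C * T m)
    (h0 : 0 ≤ u 0 ∧ u 0 ≤ ε * C * T 0) (h1 : 0 ≤ u 1 ∧ u 1 ≤ ε * C * T 1) (m : ℕ) :
    0 ≤ u m ∧ u m ≤ ε * C * T m := by
  induction m using Nat.twoStepInduction with
  | zero => exact h0
  | one => exact h1
  | more m _ ih =>
    have hεq := mul_nonneg hε (hq m)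
    rw [hu, hT]
    refine ⟨add_nonneg ih.1 (mul_nonneg hεq (hv m).1), ?_⟩
    have := mul_le_mul_of_nonneg_left (hv m).2 hεq
    linarith [ih.2]

lemma finiteSizeFactor_one_nonneg {α : ℝ} (hα : -1 < α) (m : ℕ) :
    0 ≤ finiteSizeFactor α 1 m := by
  induction m using Nat.twoStepInduction with
  | zero => simp [finiteSizeFactor]
  | one => simp [finiteSizeFactor]
  | more m ih0 ih1 =>
    rw [finiteSizeFactor, one_mul]
    exact add_nonneg ih1 (mul_nonneg (factor_step_nonneg hα m) ih0)

lemma finiteSizeFactor_nonneg_and_le {α : ℝ} (hα : -1 < α) {ε : ℝ} (hε : 0 ≤ ε) (hε1 : ε ≤ 1)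
    (m : ℕ) : 0 ≤ finiteSizeFactor α ε m ∧ finiteSizeFactor α ε m ≤ finiteSizeFactor α 1 m := by
  induction m using Nat.twoStepInduction with
  | zero => simp [finiteSizeFactor]
  | one => simp [finiteSizeFactor]
  | more m ih0 ih1 =>
    have hq := factor_step_nonneg hα m
    rw [finiteSizeFactor, finiteSizeFactor]
    refine ⟨add_nonneg ih1.1 (mul_nonneg (mul_nonneg hε hq) ih0.1), ?_⟩
    have := mul_le_mul (mul_le_mul_of_nonneg_right hε1 hq) ih0.2 ih0.1 (by linarith)
    linarith [ih1.2]

/-- The terms 1, ε and ε² are subtracted one at a time. Each new remainder solves the recursion with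
ε times the previous remainder as source, so comparison with the solution at ε = 1 gains one factor
ε per step. The remainders stay nonnegative. -/
lemma abs_finiteSizeFactor_sub_le {α : ℝ} (hα : -1 < α) {ε : ℝ} (hε : 0 ≤ ε) (hε1 : ε ≤ 1)
    (m : ℕ) :
    |finiteSizeFactor α ε m - (1 + ε * factorOne α m + ε ^ 2 * factorTwo α m)| ≤
      ε ^ 3 * finiteSizeFactor α 1 m := by
  have hT (m : ℕ) : finiteSizeFactor α 1 (m + 2) = finiteSizeFactor α 1 (m + 1) +
      ((m : ℝ) + 1) * (m + 1 + α) / 4 * finiteSizeFactor α 1 m := by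
    rw [finiteSizeFactor, one_mul]
  have hone (m : ℕ) := nonneg_and_le_mul_of_recursion
    (u := fun m => finiteSizeFactor α ε m - 1) (v := finiteSizeFactor α ε) (C := 1) hε
    (factor_step_nonneg hα) (fun m => by rw [finiteSizeFactor]; ring) hT
    (fun m => by simpa using finiteSizeFactor_nonneg_and_le hα hε hε1 m)
    (by simp [finiteSizeFactor, hε]) (by simp [finiteSizeFactor, hε]) m
  have htwo (m : ℕ) := nonneg_and_le_mul_of_recursion
    (u := fun m : ℕ => finiteSizeFactor α ε m - 1 - ε * factorOne α m)
    (v := fun m => finiteSizeFactor α ε m - 1) hε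
    (factor_step_nonneg hα) (fun m => by
      rw [finiteSizeFactor]
      push_cast
      rw [factorOne_add_two]
      ring) hT hone
    (by simp [finiteSizeFactor, factorOne, hε, mul_nonneg])
    (by simp [finiteSizeFactor, factorOne, hε, mul_nonneg]) m
  have hthree := nonneg_and_le_mul_of_recursion
    (u := fun m : ℕ => finiteSizeFactor α ε m - 1 - ε * factorOne α m - ε ^ 2 * factorTwo α m)
    (v := fun m : ℕ => finiteSizeFactor α ε m - 1 - ε * factorOne α m) hε
    (factor_step_nonneg hα) (fun m => by
      rw [finiteSizeFactor]
      push_cast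
      rw [factorOne_add_two, factorTwo_add_two]
      ring) hT htwo
    (by simp [finiteSizeFactor, factorOne, factorTwo, hε, mul_nonneg])
    (by
      have : factorTwo α 1 = 0 := by unfold factorTwo; ring
      simp [finiteSizeFactor, factorOne, this, hε, mul_nonneg]) m
  rw [abs_of_nonneg (by linarith [hthree.1])]
  linarith [hthree.2]

/-- A crude bound suffices: the Bessel coefficients decay like 4⁻ᵐ/m!², so one factorial may be
lost. -/
lemma finiteSizeFactor_one_le {α : ℝ} (hα : -1 < α) (m : ℕ) :
    finiteSizeFactor α 1 m ≤ (2 + |α|) ^ m * m.factorial := by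
  have hA := abs_nonneg α
  have hαA := le_abs_self α
  induction m using Nat.twoStepInduction with
  | zero => simp [finiteSizeFactor]
  | one => simp [finiteSizeFactor]; linarith
  | more m ih0 ih1 =>
    have hq := factor_step_nonneg hα m
    have hm : (0 : ℝ) ≤ m := m.cast_nonneg
    have hle : ((m : ℝ) + 1) * (m + 1 + α) / 4 ≤ (m + 1) * ((m + 2) * (1 + |α|)) / 4 := by
      gcongr
      nlinarith
    have hX : 0 ≤ (2 + |α|) ^ m * ((m : ℝ) + 1) * m.factorial := by positivity
    have h := mul_le_mul hle ih0 (finiteSizeFactor_one_nonneg hα m) (by positivity)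
    rw [finiteSizeFactor, one_mul, Nat.factorial_succ, Nat.factorial_succ]
    rw [Nat.factorial_succ] at ih1
    push_cast at ih1 ⊢
    calc _ ≤ (2 + |α|) ^ (m + 1) * ((m + 1) * m.factorial) +
          (m + 1) * ((m + 2) * (1 + |α|)) / 4 * ((2 + |α|) ^ m * m.factorial) := add_le_add ih1 h
      _ = (2 + |α|) ^ m * ((m : ℝ) + 1) * m.factorial *
          ((2 + |α|) + (m + 2) * (1 + |α|) / 4) := by ring
      _ ≤ (2 + |α|) ^ m * ((m : ℝ) + 1) * m.factorial * ((m + 2) * (2 + |α|) ^ 2) := by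
        gcongr
        nlinarith [mul_nonneg hm hA, mul_nonneg hm (sq_nonneg |α|), sq_nonneg |α|]
      _ = _ := by ring

/-! ### Summability -/

lemma abs_besselCoeff_le {ν : ℝ} (hν : 0 ≤ ν) (m : ℕ) :
    |besselCoeff ν m| ≤ 1 / Real.Gamma (ν + 1) * ((1 / 4) ^ m / (m.factorial : ℝ) ^ 2) := by
  have hG : 0 < Real.Gamma (ν + 1) := Real.Gamma_pos_of_pos (by linarith)
  have hle : Real.Gamma (ν + 1) * m.factorial ≤ Real.Gamma (m + ν + 1) := by
    induction m with
    | zero => simp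
    | succ m ih =>
      have hm : (0 : ℝ) ≤ m := m.cast_nonneg
      rw [Gamma_natCast_succ_add (by linarith), Nat.factorial_succ]
      push_cast
      calc Real.Gamma (ν + 1) * ((m + 1) * m.factorial)
          = (m + 1) * (Real.Gamma (ν + 1) * m.factorial) := by ring
        _ ≤ (m + ν + 1) * Real.Gamma (m + ν + 1) := by gcongr; linarith
  have hf : (0 : ℝ) < m.factorial := by positivity
  rw [besselCoeff, abs_div, abs_pow, abs_of_pos (mul_pos hf (Gamma_natCast_add_pos (by linarith) m))]
  rw [show |(-1 / 4 : ℝ)| = 1 / 4 by rw [abs_div]; norm_num]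
  calc (1 / 4 : ℝ) ^ m / (m.factorial * Real.Gamma (m + ν + 1))
      ≤ (1 / 4 : ℝ) ^ m / (m.factorial * (Real.Gamma (ν + 1) * m.factorial)) := by gcongr
    _ = _ := by field_simp

lemma natCast_pow_le_exp (k m : ℕ) : (m : ℝ) ^ k ≤ k.factorial * Real.exp 1 ^ m := by
  have h := Real.pow_div_factorial_le_exp (m : ℝ) m.cast_nonneg k
  rw [div_le_iff₀ (by positivity)] at h
  rw [← Real.exp_nat_mul, mul_one]
  linarith

/-- Summability of the majorant series. -/
lemma summable_pow_mul_besselCoeff_mul_factor {ν : ℝ} (hν : 0 ≤ ν) (k : ℕ) (y : ℝ) :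
    Summable fun m : ℕ =>
      (m : ℝ) ^ k * (|besselCoeff ν m| * finiteSizeFactor ν 1 m * |y| ^ m) := by
  -- The power m^k is absorbed by k! eᵐ, and one factorial of `besselCoeff` cancels that of
  -- `finiteSizeFactor`; an exponential series remains.
  have hs := (Real.summable_pow_div_factorial
    (Real.exp 1 * (1 / 4) * (2 + |ν|) * |y|)).mul_left (k.factorial * (1 / Real.Gamma (ν + 1)))
  have hG : 0 < Real.Gamma (ν + 1) := Real.Gamma_pos_of_pos (by linarith)
  have hν' : -1 < ν := by linarith
  refine Summable.of_nonneg_of_le (fun m => ?_) (fun m => ?_) hs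
  · have := finiteSizeFactor_one_nonneg hν' m
    positivity
  · have hf : (0 : ℝ) < m.factorial := by positivity
    have h0 := finiteSizeFactor_one_nonneg hν' m
    calc (m : ℝ) ^ k * (|besselCoeff ν m| * finiteSizeFactor ν 1 m * |y| ^ m)
        ≤ (k.factorial * Real.exp 1 ^ m) *
          ((1 / Real.Gamma (ν + 1) * ((1 / 4) ^ m / (m.factorial : ℝ) ^ 2)) *
            ((2 + |ν|) ^ m * m.factorial) * |y| ^ m) := by
          gcongr
          · exact natCast_pow_le_exp k m
          · exact abs_besselCoeff_le hν m
          · exact finiteSizeFactor_one_le hν' m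
      _ = _ := by
          simp only [mul_pow]
          field_simp

lemma one_le_finiteSizeFactor_one {α : ℝ} (hα : -1 < α) (m : ℕ) :
    1 ≤ finiteSizeFactor α 1 m := by
  -- At ε = 0 the error bound vanishes.
  have h0 : finiteSizeFactor α 0 m = 1 := by
    simpa [sub_eq_zero] using abs_finiteSizeFactor_sub_le hα le_rfl zero_le_one m
  exact h0 ▸ (finiteSizeFactor_nonneg_and_le hα le_rfl zero_le_one m).2

/-! ### Moments of the Bessel coefficients -/

/-- The `k`-th power of the Euler operator applied to the Bessel series. -/
def besselMoment (ν y : ℝ) (k : ℕ) : ℝ := ∑' m : ℕ, (m : ℝ) ^ k * (besselCoeff ν m * y ^ m)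

lemma summable_besselMoment {ν : ℝ} (hν : 0 ≤ ν) (y : ℝ) (k : ℕ) :
    Summable fun m : ℕ => (m : ℝ) ^ k * (besselCoeff ν m * y ^ m) := by
  refine Summable.of_norm_bounded (summable_pow_mul_besselCoeff_mul_factor hν k y) fun m => ?_
  rw [Real.norm_eq_abs, abs_mul, abs_mul, abs_pow, abs_pow, Nat.abs_cast]
  gcongr
  exact le_mul_of_one_le_right (abs_nonneg _) (one_le_finiteSizeFactor_one (by linarith) m)

lemma hasSum_besselMoment {ν : ℝ} (hν : 0 ≤ ν) (y : ℝ) (k : ℕ) :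
    HasSum (fun m : ℕ => (m : ℝ) ^ k * (besselCoeff ν m * y ^ m)) (besselMoment ν y k) :=
  (summable_besselMoment hν y k).hasSum

/-- Bessel's equation in terms of moments. -/
lemma besselMoment_add_two {ν : ℝ} (hν : 0 ≤ ν) (y : ℝ) (k : ℕ) :
    besselMoment ν y (k + 2) = -ν * besselMoment ν y (k + 1) -
      y / 4 * ∑ i ∈ range (k + 1), (k.choose i : ℝ) * besselMoment ν y i := by
  have h1 := ((hasSum_besselMoment hν y (k + 2)).add
    ((hasSum_besselMoment hν y (k + 1)).mul_left ν))
  have h2 := (hasSum_sum fun i (_ : i ∈ range (k + 1)) =>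
    (hasSum_besselMoment hν y i).mul_left (k.choose i : ℝ)).mul_left (-(y / 4))
  have h3 : HasSum (fun m : ℕ => (m : ℝ) ^ (k + 2) * (besselCoeff ν m * y ^ m) +
      ν * ((m : ℝ) ^ (k + 1) * (besselCoeff ν m * y ^ m)))
      (-(y / 4) * ∑ i ∈ range (k + 1), (k.choose i : ℝ) * besselMoment ν y i) := by
    -- The term m = 0 vanishes. After the shift, `besselCoeff_succ` absorbs the factor (m + 1)(m + 1
    -- + ν), and (m + 1)^k is expanded binomially.
    rw [← hasSum_nat_add_iff' 1]
    simp only [Finset.range_one, Finset.sum_singleton, Nat.cast_zero, ne_eq, Nat.add_eq_zero_iff,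
      one_ne_zero, OfNat.ofNat_ne_zero, and_false, not_false_eq_true, zero_pow, zero_mul, mul_zero,
      add_zero, sub_zero]
    have hfun : (fun m : ℕ => ((m + 1 : ℕ) : ℝ) ^ (k + 2) * (besselCoeff ν (m + 1) * y ^ (m + 1)) +
        ν * (((m + 1 : ℕ) : ℝ) ^ (k + 1) * (besselCoeff ν (m + 1) * y ^ (m + 1)))) =
        fun m : ℕ => -(y / 4) * ∑ i ∈ range (k + 1),
          (k.choose i : ℝ) * ((m : ℝ) ^ i * (besselCoeff ν m * y ^ m)) := by
      funext m
      have hbin : ∑ i ∈ range (k + 1), (k.choose i : ℝ) * ((m : ℝ) ^ i * (besselCoeff ν m * y ^ m)) =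
          ((m : ℝ) + 1) ^ k * (besselCoeff ν m * y ^ m) := by
        rw [add_pow, Finset.sum_mul]
        exact Finset.sum_congr rfl fun i _ => by ring
      rw [hbin, besselCoeff_succ (by linarith) m]
      push_cast
      ring
    rw [hfun]
    exact h2
  linarith [h1.unique h3]

/-- The first order correction to the scaled Laguerre function, in terms of moments. -/
def momentOne (ν y : ℝ) (k : ℕ) : ℝ :=
  1 / 12 * besselMoment ν y (k + 3) + (ν - 1) / 8 * besselMoment ν y (k + 2) +
    (1 - 3 * ν) / 24 * besselMoment ν y (k + 1)

/-- The second order correction to the scaled Laguerre function, in terms of moments. -/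
def momentTwo (ν y : ℝ) (k : ℕ) : ℝ :=
  (-7 / 960 + ν / 16 - 3 * ν ^ 2 / 64) * besselMoment ν y (k + 1) +
    (73 / 1152 - 17 * ν / 96 + 11 * ν ^ 2 / 128) * besselMoment ν y (k + 2) +
    (-23 / 192 + 17 * ν / 96 - 3 * ν ^ 2 / 64) * besselMoment ν y (k + 3) +
    (103 / 1152 - 7 * ν / 96 + ν ^ 2 / 128) * besselMoment ν y (k + 4) +
    (-7 / 240 + ν / 96) * besselMoment ν y (k + 5) + 1 / 288 * besselMoment ν y (k + 6)

lemma abs_tsum_finiteSizeFactor_sub_le {ν : ℝ} (hν : 0 ≤ ν) (y : ℝ) (k : ℕ) {ε : ℝ} (hε : 0 ≤ ε)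
    (hε1 : ε ≤ 1) :
    |∑' m : ℕ, (m : ℝ) ^ k * (besselCoeff ν m * finiteSizeFactor ν ε m * y ^ m) -
        (besselMoment ν y k + momentOne ν y k * ε + momentTwo ν y k * ε ^ 2)| ≤
      (∑' m : ℕ, (m : ℝ) ^ k * (|besselCoeff ν m| * finiteSizeFactor ν 1 m * |y| ^ m)) * ε ^ 3 := by
  have hν' : -1 < ν := by linarith
  have hM := hasSum_besselMoment hν y
  have hmaj := summable_pow_mul_besselCoeff_mul_factor hν k y
  have hsum : Summable fun m : ℕ =>
      (m : ℝ) ^ k * (besselCoeff ν m * finiteSizeFactor ν ε m * y ^ m) := by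
    refine Summable.of_norm_bounded hmaj fun m => ?_
    have := finiteSizeFactor_nonneg_and_le hν' hε hε1 m
    rw [Real.norm_eq_abs, abs_mul, abs_mul, abs_mul, abs_pow, abs_pow, Nat.abs_cast,
      abs_of_nonneg this.1]
    gcongr
    exact this.2
  -- The constants in `momentOne` and `momentTwo` are the coefficients of `factorOne` and
  -- `factorTwo` as polynomials in m.
  have hpoly : HasSum (fun m : ℕ => (m : ℝ) ^ k * (besselCoeff ν m *
      (1 + ε * factorOne ν m + ε ^ 2 * factorTwo ν m) * y ^ m))
      (besselMoment ν y k + momentOne ν y k * ε + momentTwo ν y k * ε ^ 2) := by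
    have h1 := ((((hM (k + 3)).mul_left (1 / 12)).add ((hM (k + 2)).mul_left ((ν - 1) / 8))).add
      ((hM (k + 1)).mul_left ((1 - 3 * ν) / 24))).mul_right ε
    have h2 := ((((((hM (k + 1)).mul_left (-7 / 960 + ν / 16 - 3 * ν ^ 2 / 64)).add
      ((hM (k + 2)).mul_left (73 / 1152 - 17 * ν / 96 + 11 * ν ^ 2 / 128))).add
      ((hM (k + 3)).mul_left (-23 / 192 + 17 * ν / 96 - 3 * ν ^ 2 / 64))).add
      ((hM (k + 4)).mul_left (103 / 1152 - 7 * ν / 96 + ν ^ 2 / 128))).add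
      ((hM (k + 5)).mul_left (-7 / 240 + ν / 96))).add ((hM (k + 6)).mul_left (1 / 288))
    have h := ((hM k).add h1).add (h2.mul_right (ε ^ 2))
    rw [momentOne, momentTwo]
    convert h using 2 with m
    unfold factorOne factorTwo
    ring
  rw [← (hsum.hasSum.sub hpoly).tsum_eq, ← tsum_mul_right, ← Real.norm_eq_abs]
  refine tsum_of_norm_bounded (hmaj.mul_right (ε ^ 3)).hasSum fun m => ?_
  have := abs_finiteSizeFactor_sub_le hν' hε hε1 m
  rw [Real.norm_eq_abs, ← mul_sub, ← sub_mul, ← mul_sub, abs_mul, abs_mul, abs_mul, abs_pow,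
    abs_pow, Nat.abs_cast]
  calc _ ≤ (m : ℝ) ^ k * (|besselCoeff ν m| * (ε ^ 3 * finiteSizeFactor ν 1 m) * |y| ^ m) := by
        gcongr
    _ = _ := by ring

/-! ### Second order expansions -/

/-- `f` has the expansion `c₀ + c₁ ε + c₂ ε ^ 2 + O(ε ^ 3)`. -/
def HasExpansion (ε f : ℕ → ℝ) (c₀ c₁ c₂ : ℝ) : Prop :=
  (fun n => f n - (c₀ + c₁ * ε n + c₂ * ε n ^ 2)) =O[atTop] fun n => ε n ^ 3

namespace HasExpansion

variable {ε f g : ℕ → ℝ} {c₀ c₁ c₂ d₀ d₁ d₂ : ℝ}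

lemma const (c : ℝ) : HasExpansion ε (fun _ => c) c 0 0 := by
  simp [HasExpansion, isBigO_zero]

lemma self : HasExpansion ε ε 0 1 0 := by
  simp [HasExpansion, isBigO_zero]

lemma congr' (hf : HasExpansion ε f c₀ c₁ c₂) (h : f =ᶠ[atTop] g) :
    HasExpansion ε g c₀ c₁ c₂ :=
  IsBigO.congr' hf (h.mono fun n hn => by simp only [hn]) EventuallyEq.rfl

lemma congr_coeff (hf : HasExpansion ε f c₀ c₁ c₂) (h₀ : c₀ = d₀) (h₁ : c₁ = d₁) (h₂ : c₂ = d₂) :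
    HasExpansion ε f d₀ d₁ d₂ := by
  rwa [← h₀, ← h₁, ← h₂]

lemma add (hf : HasExpansion ε f c₀ c₁ c₂) (hg : HasExpansion ε g d₀ d₁ d₂) :
    HasExpansion ε (fun n => f n + g n) (c₀ + d₀) (c₁ + d₁) (c₂ + d₂) := by
  refine (IsBigO.add hf hg).congr_left fun n => ?_
  ring

lemma tendsto (hε : Tendsto ε atTop (𝓝 0)) (hf : HasExpansion ε f c₀ c₁ c₂) :
    Tendsto f atTop (𝓝 c₀) := by
  have h3 : Tendsto (fun n => ε n ^ 3) atTop (𝓝 0) := by simpa using hε.pow 3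
  have h1 := (IsBigO.trans_tendsto hf h3).add
    ((tendsto_const_nhds (x := c₀)).add (hε.const_mul c₁) |>.add ((hε.pow 2).const_mul c₂))
  simpa using h1

lemma mul (hε : Tendsto ε atTop (𝓝 0)) (hf : HasExpansion ε f c₀ c₁ c₂)
    (hg : HasExpansion ε g d₀ d₁ d₂) :
    HasExpansion ε (fun n => f n * g n) (c₀ * d₀) (c₀ * d₁ + c₁ * d₀)
      (c₀ * d₂ + c₁ * d₁ + c₂ * d₀) := by
  have hg1 : g =O[atTop] fun _ => (1 : ℝ) := (hg.tendsto hε).isBigO_one ℝ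
  have hP : (fun n => c₀ + c₁ * ε n + c₂ * ε n ^ 2) =O[atTop] fun _ => (1 : ℝ) :=
    (((tendsto_const_nhds (x := c₀)).add (hε.const_mul c₁)).add
      ((hε.pow 2).const_mul c₂)).isBigO_one ℝ
  -- These are the ε³ and ε⁴ terms of the product of the two truncations, divided by ε³.
  have hR : (fun n => c₁ * d₂ + c₂ * d₁ + c₂ * d₂ * ε n) =O[atTop] fun _ => (1 : ℝ) :=
    ((tendsto_const_nhds (x := c₁ * d₂ + c₂ * d₁)).add (hε.const_mul (c₂ * d₂))).isBigO_one ℝ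
  have h1 := IsBigO.mul hf hg1
  have h2 := IsBigO.mul hP hg
  have h3 := IsBigO.mul hR (isBigO_refl (fun n => ε n ^ 3) atTop)
  simp only [one_mul, mul_one] at h1 h2 h3
  refine ((h1.add h2).add h3).congr_left fun n => ?_
  ring

lemma const_mul (hε : Tendsto ε atTop (𝓝 0)) (c : ℝ) (hf : HasExpansion ε f c₀ c₁ c₂) :
    HasExpansion ε (fun n => c * f n) (c * c₀) (c * c₁) (c * c₂) := by
  simpa using (const c).mul hε hf

lemma exp (hε : Tendsto ε atTop (𝓝 0)) (hf : HasExpansion ε f 0 c₁ c₂) :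
    HasExpansion ε (fun n => Real.exp (f n)) 1 c₁ (c₂ + c₁ ^ 2 / 2) := by
  have hf0 := hf.tendsto hε
  have hbig := (Real.exp_sub_sum_range_isBigO_pow 3).comp_tendsto hf0
  have hfε : f =O[atTop] ε := by
    have h3 : (fun n => ε n ^ 3) =O[atTop] ε := by
      have := ((hε.pow 2).isBigO_one ℝ).mul (isBigO_refl ε atTop)
      simpa [← pow_succ] using this
    have h2 : (fun n => ε n ^ 2) =O[atTop] ε := by
      have := (hε.isBigO_one ℝ).mul (isBigO_refl ε atTop)
      simpa [← sq] using this
    have := (IsBigO.trans hf h3).add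
      (((isBigO_refl ε atTop).const_mul_left c₁).add (h2.const_mul_left c₂))
    refine this.congr_left fun n => ?_
    ring
  have hrem : (fun n => Real.exp (f n) - (1 + f n + 1 / 2 * (f n * f n))) =O[atTop]
      fun n => ε n ^ 3 := by
    refine (hbig.trans (hfε.pow 3)).congr_left fun n => ?_
    simp [Finset.sum_range_succ]
    ring
  have hmain := ((const 1).add hf).add ((hf.mul hε hf).const_mul hε (1 / 2))
  refine (hrem.add hmain).congr_left fun n => ?_
  ring

end HasExpansion

/-! ### Ratio of Gamma functions -/

lemma log_one_add_mul_isBigO (c : ℝ) :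
    (fun h : ℝ => Real.log (1 + c * h) - (c * h - (c * h) ^ 2 / 2 + (c * h) ^ 3 / 3 -
      (c * h) ^ 4 / 4 + (c * h) ^ 5 / 5 - (c * h) ^ 6 / 6)) =O[𝓝 0] fun h => h ^ 7 := by
  have htend : Tendsto (fun h : ℝ => |c * h|) (𝓝 0) (𝓝 0) := by
    have : Continuous fun h : ℝ => |c * h| := by fun_prop
    simpa using this.tendsto 0
  refine IsBigO.of_bound (2 * |c| ^ 7) ?_
  filter_upwards [htend.eventually (gt_mem_nhds (show (0 : ℝ) < 1 / 2 by norm_num))] with h hh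
  have hb := Real.abs_log_sub_add_sum_range_le (x := -(c * h)) (by rw [abs_neg]; linarith) 6
  rw [abs_neg] at hb
  simp only [Finset.sum_range_succ, Finset.sum_range_zero] at hb
  rw [Real.norm_eq_abs, Real.norm_eq_abs, abs_pow]
  have hle : |c * h| ^ (6 + 1) / (1 - |c * h|) ≤ 2 * |c| ^ 7 * |h| ^ 7 := by
    rw [div_le_iff₀ (by linarith), abs_mul, mul_pow]
    rw [abs_mul] at hh
    have h7 : 0 ≤ |c| ^ 7 * |h| ^ 7 := by positivity
    have := mul_nonneg h7 (sub_nonneg.2 hh.le)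
    norm_num
    linarith
  refine le_trans (le_of_eq ?_) (hb.trans hle)
  congr 1
  rw [show 1 - -(c * h) = 1 + c * h by ring]
  push_cast
  ring

/-- First coefficient of the logarithm of the Gamma ratio. -/
def logGammaOne (s : ℝ) : ℝ := -((s + 1) * s * (s - 1)) / 24

/-- Second coefficient of the logarithm of the Gamma ratio. -/
def logGammaTwo (s : ℝ) : ℝ := (s + 1) * s * (s - 1) * (7 - 3 * s ^ 2) / 960

/-- With h = 1/κ, the next value of 1/κ is h/(1 + h). The logarithms are the increment of log
`gammaRatio`; the rest is that of the ansatz c₁κ⁻² + c₂κ⁻⁴. Order h³ fixes `logGammaOne`, order h⁵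
fixes `logGammaTwo`, and all other orders up to h⁶ cancel. -/
lemma log_increment_isBigO (s : ℝ) :
    (fun h : ℝ => Real.log (1 + (1 + s) / 2 * h) - Real.log (1 + (1 - s) / 2 * h) -
      s * Real.log (1 + 1 * h) - logGammaOne s * (h ^ 2 / (1 + h) ^ 2 - h ^ 2) -
      logGammaTwo s * (h ^ 4 / (1 + h) ^ 4 - h ^ 4)) =O[𝓝 0] fun h => h ^ 7 := by
  have hbdd (p : ℝ → ℝ) (k : ℕ) (hp : Continuous p) :
      (fun h => p h / (1 + h) ^ k * h ^ 7) =O[𝓝 0] fun h : ℝ => h ^ 7 := by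
    have hc : ContinuousAt (fun h => p h / (1 + h) ^ k) 0 := by
      refine ContinuousAt.div hp.continuousAt (by fun_prop) (by simp)
    have := (hc.tendsto.isBigO_one ℝ).mul (isBigO_refl (fun h : ℝ => h ^ 7) (𝓝 0))
    simpa using this
  -- The numerators here and in `h4` come from the exact remainders of the Taylor expansions of
  -- h²/(1 + h)² and h⁴/(1 + h)⁴ through h⁶.
  have h2 := (hbdd (fun h => 6 + 5 * h) 2 (by fun_prop)).const_mul_left (logGammaOne s)
  have h4 := (hbdd (fun h => 20 + 45 * h + 36 * h ^ 2 + 10 * h ^ 3) 4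
    (by fun_prop)).const_mul_left (logGammaTwo s)
  have hl := ((log_one_add_mul_isBigO ((1 + s) / 2)).sub (log_one_add_mul_isBigO ((1 - s) / 2))).sub
    ((log_one_add_mul_isBigO 1).const_mul_left s)
  refine ((hl.add h2).add h4).congr' ?_ EventuallyEq.rfl
  filter_upwards [lt_mem_nhds (show (-1 : ℝ) < 0 by norm_num)] with h hh
  have hne : 1 + h ≠ 0 := by linarith
  have e2 : (6 + 5 * h) / (1 + h) ^ 2 * h ^ 7 =
      h ^ 2 - 2 * h ^ 3 + 3 * h ^ 4 - 4 * h ^ 5 + 5 * h ^ 6 - h ^ 2 / (1 + h) ^ 2 := by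
    field_simp
    ring
  have e4 : (20 + 45 * h + 36 * h ^ 2 + 10 * h ^ 3) / (1 + h) ^ 4 * h ^ 7 =
      h ^ 4 - 4 * h ^ 5 + 10 * h ^ 6 - h ^ 4 / (1 + h) ^ 4 := by
    field_simp
    ring
  rw [e2, e4]
  unfold logGammaOne logGammaTwo
  ring

/-- A null sequence with increments of order `κ ^ (-7)`, where `κ n = n + c`, is of order
`κ ^ (-6)`. -/
lemma isBigO_of_increment_isBigO {u κ : ℕ → ℝ} (hκ : Tendsto κ atTop atTop)
    (hstep : ∀ n, κ (n + 1) = κ n + 1) (hu : Tendsto u atTop (𝓝 0))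
    (hinc : (fun n => u (n + 1) - u n) =O[atTop] fun n => (1 / κ n) ^ 7) :
    u =O[atTop] fun n => (1 / κ n) ^ 6 := by
  obtain ⟨K, hKpos, hK⟩ := hinc.exists_pos
  rw [isBigOWith_iff] at hK
  obtain ⟨n₀, hn₀⟩ := eventually_atTop.1 (hK.and (hκ.eventually_ge_atTop 1))
  -- The increments are dominated by the telescoping decrements of κ⁻⁶; 64 = 2⁶ comes from κ + 1 ≤
  -- 2κ for κ ≥ 1.
  have hgap (n : ℕ) (hn : n₀ ≤ n) :
      |u (n + 1) - u n| ≤ 64 * K * ((1 / κ n) ^ 6 - (1 / κ (n + 1)) ^ 6) := by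
    obtain ⟨h1, h2⟩ := hn₀ n hn
    have hpos : 0 < κ n := by linarith
    rw [Real.norm_eq_abs, Real.norm_eq_abs, abs_of_nonneg (by positivity : 0 ≤ (1 / κ n) ^ 7)] at h1
    refine h1.trans ?_
    rw [hstep, mul_comm 64, mul_assoc]
    refine mul_le_mul_of_nonneg_left ?_ hKpos.le
    have h64 : (κ n + 1) ^ 6 ≤ 64 * κ n ^ 6 := by
      calc (κ n + 1) ^ 6 ≤ (2 * κ n) ^ 6 := by gcongr; linarith
        _ = _ := by ring
    have hdiff : κ n ^ 5 ≤ (κ n + 1) ^ 6 - κ n ^ 6 := by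
      have : (κ n + 1) ^ 6 - κ n ^ 6 = κ n ^ 5 + (5 * κ n ^ 5 + 15 * κ n ^ 4 + 20 * κ n ^ 3 +
        15 * κ n ^ 2 + 6 * κ n + 1) := by ring
      rw [this]
      have : 0 ≤ 5 * κ n ^ 5 + 15 * κ n ^ 4 + 20 * κ n ^ 3 + 15 * κ n ^ 2 + 6 * κ n + 1 := by
        positivity
      linarith
    have heq : 64 * ((1 / κ n) ^ 6 - (1 / (κ n + 1)) ^ 6) =
        64 * ((κ n + 1) ^ 6 - κ n ^ 6) / (κ n ^ 6 * (κ n + 1) ^ 6) := by field_simp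
    rw [heq, le_div_iff₀ (by positivity)]
    calc (1 / κ n) ^ 7 * (κ n ^ 6 * (κ n + 1) ^ 6) ≤ (1 / κ n) ^ 7 * (κ n ^ 6 * (64 * κ n ^ 6)) := by
          gcongr
      _ = 64 * κ n ^ 5 := by field_simp
      _ ≤ _ := by linarith
  have hlim : Tendsto (fun n => 64 * K * (1 / κ n) ^ 6) atTop (𝓝 0) := by
    have : Tendsto (fun n => 1 / κ n) atTop (𝓝 0) :=
      hκ.inv_tendsto_atTop.congr fun n => (one_div _).symm
    simpa using (this.pow 6).const_mul (64 * K)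
  have hadd : Tendsto (fun n => u n + 64 * K * (1 / κ n) ^ 6) atTop (𝓝 0) := by
    have := hu.add hlim
    rwa [add_zero] at this
  have hsub : Tendsto (fun n => u n - 64 * K * (1 / κ n) ^ 6) atTop (𝓝 0) := by
    have := hu.sub hlim
    rwa [sub_zero] at this
  refine IsBigO.of_bound (64 * K) (eventually_atTop.2 ⟨n₀, fun n hn => ?_⟩)
  have hpos : 0 < κ n := by linarith [(hn₀ n hn).2]
  rw [Real.norm_eq_abs, Real.norm_eq_abs, abs_of_nonneg (by positivity : 0 ≤ (1 / κ n) ^ 6), abs_le]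
  constructor
  -- Adding or subtracting 64Kκ⁻⁶ makes u monotone with limit 0, which gives the two one-sided
  -- bounds.
  · have hanti : Antitone fun k => u (k + n₀) + 64 * K * (1 / κ (k + n₀)) ^ 6 := by
      refine antitone_nat_of_succ_le fun k => ?_
      have := (abs_le.1 (hgap (k + n₀) (by omega))).2
      rw [show k + 1 + n₀ = k + n₀ + 1 by ring]
      linarith
    have h := hanti.le_of_tendsto
      ((tendsto_add_atTop_iff_nat (f := fun k => u k + 64 * K * (1 / κ k) ^ 6) n₀).2 hadd) (n - n₀)
    simp only [Nat.sub_add_cancel hn] at h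
    linarith
  · have hmono : Monotone fun k => u (k + n₀) - 64 * K * (1 / κ (k + n₀)) ^ 6 := by
      refine monotone_nat_of_le_succ fun k => ?_
      have := (abs_le.1 (hgap (k + n₀) (by omega))).1
      rw [show k + 1 + n₀ = k + n₀ + 1 by ring]
      linarith
    have h := hmono.ge_of_tendsto
      ((tendsto_add_atTop_iff_nat (f := fun k => u k - 64 * K * (1 / κ k) ^ 6) n₀).2 hsub) (n - n₀)
    simp only [Nat.sub_add_cancel hn] at h
    linarith

/-- The Gamma ratio `Γ(n + s + 1) / (n! κ ^ s)` with `κ = n + (s + 1) / 2`. -/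
def gammaRatio (s : ℝ) (n : ℕ) : ℝ :=
  Real.Gamma (n + s + 1) / (n.factorial * (n + (s + 1) / 2) ^ s)

lemma gammaRatio_pos {s : ℝ} (hs : 0 < s) (n : ℕ) : 0 < gammaRatio s n := by
  have := Gamma_natCast_add_pos (show -1 < s by linarith) n
  unfold gammaRatio
  positivity

lemma tendsto_natCast_add_atTop (c : ℝ) : Tendsto (fun n : ℕ => (n : ℝ) + c) atTop atTop :=
  tendsto_atTop_add_const_right _ _ tendsto_natCast_atTop_atTop

/-- Increments determine log `gammaRatio` only up to a constant, which this limit fixes. The ratio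
is Γ(s) over Euler's sequence for Γ(s), times (n/κ)^s. -/
lemma tendsto_gammaRatio {s : ℝ} (hs : 0 < s) : Tendsto (gammaRatio s) atTop (𝓝 1) := by
  have hΓ : Real.Gamma s ≠ 0 := (Real.Gamma_pos_of_pos hs).ne'
  have h1 : Tendsto (fun n => Real.Gamma s / Real.GammaSeq s n) atTop (𝓝 1) := by
    have := (tendsto_const_nhds (x := Real.Gamma s)).div (Real.GammaSeq_tendsto_Gamma s) hΓ
    rwa [div_self hΓ] at this
  have h2 : Tendsto (fun n : ℕ => ((n : ℝ) / (n + (s + 1) / 2)) ^ s) atTop (𝓝 1) := by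
    have h : Tendsto (fun n : ℕ => (n : ℝ) / (n + (s + 1) / 2)) atTop (𝓝 1) :=
      tendsto_natCast_div_add_atTop ((s + 1) / 2)
    simpa using h.rpow_const (p := s) (Or.inl one_ne_zero)
  have h3 := h1.mul h2
  rw [one_mul] at h3
  refine h3.congr' ?_
  filter_upwards [eventually_gt_atTop 0] with n hn
  have hn' : (0 : ℝ) < n := by exact_mod_cast hn
  have hprod : Real.Gamma (n + s + 1) =
      (∏ j ∈ range (n + 1), (s + j)) * Real.Gamma s := by
    clear hn hn'
    induction n with
    | zero => simp [Real.Gamma_add_one hs.ne']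
    | succ n ih =>
      rw [Gamma_natCast_succ_add (by linarith), ih, Finset.prod_range_succ _ (n + 1)]
      push_cast
      ring
  have hpne : ∏ j ∈ range (n + 1), (s + (j : ℝ)) ≠ 0 :=
    Finset.prod_ne_zero_iff.2 fun j _ => by positivity
  have hns : (n : ℝ) ^ s ≠ 0 := (Real.rpow_pos_of_pos hn' s).ne'
  have hκs : ((n : ℝ) + (s + 1) / 2) ^ s ≠ 0 := (Real.rpow_pos_of_pos (by positivity) s).ne'
  rw [gammaRatio, Real.GammaSeq, hprod, Real.div_rpow hn'.le (by positivity)]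
  field_simp

lemma log_gammaRatio_succ {s : ℝ} (hs : 0 < s) (n : ℕ) {h : ℝ} (hh : h = 1 / (n + (s + 1) / 2)) :
    Real.log (gammaRatio s (n + 1)) - Real.log (gammaRatio s n) =
      Real.log (1 + (1 + s) / 2 * h) - Real.log (1 + (1 - s) / 2 * h) -
        s * Real.log (1 + 1 * h) := by
  have hn : (0 : ℝ) ≤ n := n.cast_nonneg
  have hκ : (0 : ℝ) < n + (s + 1) / 2 := by positivity
  have hG := Gamma_natCast_add_pos (show -1 < s by linarith) n
  have e1 : 1 + (1 + s) / 2 * h = (n + s + 1) / (n + (s + 1) / 2) := by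
    rw [hh]; field_simp; ring
  have e2 : 1 + (1 - s) / 2 * h = (n + 1) / (n + (s + 1) / 2) := by
    rw [hh]; field_simp; ring
  have e3 : 1 + 1 * h = (n + 1 + (s + 1) / 2) / (n + (s + 1) / 2) := by
    rw [hh]; field_simp; ring
  have hf : (0 : ℝ) < n.factorial := by positivity
  rw [e1, e2, e3, gammaRatio, gammaRatio, Gamma_natCast_succ_add (by linarith), Nat.factorial_succ]
  push_cast
  rw [Real.log_div (by positivity) (by positivity), Real.log_div (by positivity) (by positivity),
    Real.log_div (by positivity) (by positivity), Real.log_div (by positivity) (by positivity),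
    Real.log_div (by positivity) (by positivity), Real.log_mul (by positivity) (by positivity),
    Real.log_mul (by positivity) (by positivity), Real.log_mul (by positivity) (by positivity),
    Real.log_mul (by positivity) (by positivity), Real.log_rpow (by positivity),
    Real.log_rpow hκ]
  ring

lemma hasExpansion_gammaRatio {s : ℝ} (hs : 0 < s) :
    HasExpansion (fun n : ℕ => 1 / ((n : ℝ) + (s + 1) / 2) ^ 2) (gammaRatio s) 1 (logGammaOne s)
      (logGammaTwo s + logGammaOne s ^ 2 / 2) := by
  have hκ := tendsto_natCast_add_atTop ((s + 1) / 2)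
  have hκpos (n : ℕ) : (0 : ℝ) < n + (s + 1) / 2 := by positivity
  have hh : Tendsto (fun n : ℕ => 1 / ((n : ℝ) + (s + 1) / 2)) atTop (𝓝 0) :=
    hκ.inv_tendsto_atTop.congr fun n => (one_div _).symm
  have hε : Tendsto (fun n : ℕ => 1 / ((n : ℝ) + (s + 1) / 2) ^ 2) atTop (𝓝 0) := by
    simpa using hh.pow 2
  have hlog : HasExpansion (fun n : ℕ => 1 / ((n : ℝ) + (s + 1) / 2) ^ 2)
      (fun n => Real.log (gammaRatio s n)) 0 (logGammaOne s) (logGammaTwo s) := by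
    have key := isBigO_of_increment_isBigO
      (u := fun n : ℕ => Real.log (gammaRatio s n) -
        (0 + logGammaOne s * (1 / ((n : ℝ) + (s + 1) / 2) ^ 2) +
          logGammaTwo s * (1 / ((n : ℝ) + (s + 1) / 2) ^ 2) ^ 2)) hκ
      (fun n => by push_cast; ring) ?_ ?_
    · refine key.congr_right fun n => ?_
      simp only [one_div, inv_pow, ← pow_mul]
    · have h1 := (tendsto_gammaRatio hs).log one_ne_zero
      have h2 := h1.sub (((tendsto_const_nhds (x := (0 : ℝ))).add
        (hε.const_mul (logGammaOne s))).add ((hε.pow 2).const_mul (logGammaTwo s)))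
      simpa using h2
    · refine ((log_increment_isBigO s).comp_tendsto hh).congr_left fun n => ?_
      have hpos := hκpos n
      simp only [Function.comp_apply]
      rw [← log_gammaRatio_succ hs n rfl]
      have e : 1 / ((n : ℝ) + (s + 1) / 2) / (1 + 1 / ((n : ℝ) + (s + 1) / 2)) =
          1 / (((n + 1 : ℕ) : ℝ) + (s + 1) / 2) := by
        push_cast
        field_simp
        ring
      rw [← div_pow, ← div_pow, e]
      simp only [← one_div_pow]
      generalize 1 / (((n + 1 : ℕ) : ℝ) + (s + 1) / 2) = h₁
      generalize 1 / ((n : ℝ) + (s + 1) / 2) = h₀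
      ring
  refine (hlog.exp hε).congr' (Eventually.of_forall fun n => ?_)
  exact Real.exp_log (gammaRatio_pos hs n)

/-! ### Bessel functions -/

lemma besselJ_eq (ν : ℝ) {u : ℝ} (hu : 0 < u) :
    besselJ ν u = (u / 2) ^ ν * besselMoment ν (u ^ 2) 0 := by
  rw [besselJ, besselMoment, ← tsum_mul_left]
  refine tsum_congr fun m => ?_
  have h : (u / 2) ^ (2 * (m : ℝ) + ν) = (u / 2) ^ ν * ((1 / 4) ^ m * (u ^ 2) ^ m) := by
    rw [Real.rpow_add (by positivity), mul_comm (2 : ℝ), Real.rpow_mul (by positivity),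
      Real.rpow_natCast, Real.rpow_ofNat, ← mul_pow, ← pow_mul, mul_comm m 2, pow_mul]
    rw [show (u / 2) ^ 2 = 1 / 4 * u ^ 2 by ring]
    ring
  rw [h, besselCoeff, show (-1 / 4 : ℝ) = -1 * (1 / 4) by norm_num, mul_pow (-1 : ℝ)]
  ring

/-- Everything is moved to order a + 1, which is positive, so that the summability results for ν ≥ 0
apply. -/
lemma besselCoeff_eq_mul_add_one {a : ℝ} (ha : -1 < a) (m : ℕ) :
    besselCoeff a m = (m + a + 1) * besselCoeff (a + 1) m := by
  have hm : (0 : ℝ) ≤ m := m.cast_nonneg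
  have h1 : (m : ℝ) + a + 1 ≠ 0 := by linarith
  have h2 := (Gamma_natCast_add_pos ha m).ne'
  have h3 : (m.factorial : ℝ) ≠ 0 := Nat.cast_ne_zero.2 m.factorial_ne_zero
  rw [besselCoeff, besselCoeff, ← add_assoc (m : ℝ), Real.Gamma_add_one h1]
  field_simp

lemma besselCoeff_sub_one_eq_mul {a : ℝ} (m : ℕ) :
    besselCoeff (a - 1) m = (m + a) * besselCoeff a m := by
  rw [besselCoeff, besselCoeff, show (m : ℝ) + (a - 1) + 1 = m + a by ring]
  -- At the pole the convention Γ(0) = 0 makes the left side 0, in agreement with the factor m + a.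
  by_cases h : (m : ℝ) + a = 0
  · simp [h, Real.Gamma_zero]
  · rw [Real.Gamma_add_one h]
    field_simp

lemma besselMoment_zero_eq {a : ℝ} (ha : -1 < a) (y : ℝ) :
    besselMoment a y 0 = (a + 1) * besselMoment (a + 1) y 0 + besselMoment (a + 1) y 1 := by
  have hν : 0 ≤ a + 1 := by linarith
  have h := ((hasSum_besselMoment hν y 0).mul_left (a + 1)).add (hasSum_besselMoment hν y 1)
  rw [← h.tsum_eq, besselMoment]
  refine tsum_congr fun m => ?_
  rw [besselCoeff_eq_mul_add_one ha]
  ring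

lemma besselMoment_sub_one_zero_eq {a : ℝ} (ha : -1 < a) (y : ℝ) :
    besselMoment (a - 1) y 0 =
      (a * (a + 1) - y / 4) * besselMoment (a + 1) y 0 + a * besselMoment (a + 1) y 1 := by
  have hν : 0 ≤ a + 1 := by linarith
  have h2 := besselMoment_add_two hν y 0
  simp at h2
  have h := (((hasSum_besselMoment hν y 0).mul_left (a * (a + 1))).add
    ((hasSum_besselMoment hν y 1).mul_left (2 * a + 1))).add (hasSum_besselMoment hν y 2)
  have h' : besselMoment (a - 1) y 0 = a * (a + 1) * besselMoment (a + 1) y 0 +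
      (2 * a + 1) * besselMoment (a + 1) y 1 + besselMoment (a + 1) y 2 := by
    rw [← h.tsum_eq, besselMoment]
    refine tsum_congr fun m => ?_
    rw [besselCoeff_sub_one_eq_mul, besselCoeff_eq_mul_add_one ha]
    ring
  rw [h', h2]
  ring

lemma besselCoeff_succ_mul (ν : ℝ) (m : ℕ) :
    besselCoeff ν (m + 1) * (m + 1) = -1 / 4 * besselCoeff (ν + 1) m := by
  have hm : (m : ℝ) + 1 ≠ 0 := by positivity
  rw [besselCoeff, besselCoeff, Nat.factorial_succ,
    show ((m + 1 : ℕ) : ℝ) + ν + 1 = m + (ν + 1) + 1 by push_cast; ring]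
  push_cast
  field_simp
  ring

/-- Termwise differentiation on a ball containing z. Only the differentiated series must be
dominated, and it has order a + 1; for the original series convergence at 0 is enough. -/
lemma hasDerivAt_besselMoment_zero {a : ℝ} (ha : -1 < a) (z : ℝ) :
    HasDerivAt (fun z => besselMoment a z 0) (-1 / 4 * besselMoment (a + 1) z 0) z := by
  have hν : 0 ≤ a + 1 := by linarith
  set R : ℝ := |z| + 1 with hR
  have hR0 : 0 ≤ R := by positivity
  have hu : Summable fun m : ℕ => |besselCoeff a m * m| * R ^ (m - 1) := by
    rw [← summable_nat_add_iff 1]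
    have := ((summable_besselMoment hν R 0).norm).mul_left (1 / 4)
    refine this.congr fun m => ?_
    push_cast
    rw [besselCoeff_succ_mul, Real.norm_eq_abs, pow_zero, one_mul, abs_mul,
      abs_mul, abs_pow, abs_of_nonneg hR0, abs_div, abs_neg]
    norm_num
    ring
  have hd := hasDerivAt_tsum_of_isPreconnected (t := Metric.ball (0 : ℝ) R)
    (g := fun (m : ℕ) (z : ℝ) => (m : ℝ) ^ 0 * (besselCoeff a m * z ^ m))
    (g' := fun (m : ℕ) (z : ℝ) => besselCoeff a m * m * z ^ (m - 1)) (y₀ := 0) (y := z)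
    hu Metric.isOpen_ball (convex_ball 0 R).isPreconnected
    (fun m w _ => by
      have := (hasDerivAt_pow m w).const_mul (besselCoeff a m)
      simpa [mul_assoc] using this)
    (fun m w hw => by
      rw [Real.norm_eq_abs, abs_mul, abs_pow]
      have : |w| ≤ R := by simpa using (Metric.mem_ball.1 hw).le
      gcongr)
    (Metric.mem_ball_self (by positivity))
    (summable_of_ne_finset_zero (s := {0}) fun m hm => by
      simp only [Finset.mem_singleton] at hm
      simp [hm])
    (by simp [hR])
  have hval : ∑' m : ℕ, besselCoeff a m * m * z ^ (m - 1) =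
      -1 / 4 * besselMoment (a + 1) z 0 := by
    have hs : HasSum (fun m : ℕ => besselCoeff a m * m * z ^ (m - 1))
        (-1 / 4 * besselMoment (a + 1) z 0) := by
      rw [← hasSum_nat_add_iff' 1]
      simp only [Finset.range_one, Finset.sum_singleton, Nat.cast_zero, mul_zero, zero_mul,
        sub_zero, Nat.add_sub_cancel]
      have := (hasSum_besselMoment hν z 0).mul_left (-1 / 4)
      have hfun : (fun m : ℕ => besselCoeff a (m + 1) * ((m + 1 : ℕ) : ℝ) * z ^ m) =
          fun m : ℕ => -1 / 4 * ((m : ℝ) ^ 0 * (besselCoeff (a + 1) m * z ^ m)) := by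
        funext m
        push_cast
        rw [besselCoeff_succ_mul]
        ring
      rw [hfun]
      exact this
    exact hs.tsum_eq
  rw [hval] at hd
  exact hd

lemma besselJ'_eq {a : ℝ} (ha : -1 < a) {u : ℝ} (hu : 0 < u) :
    besselJ' a u = (u / 2) ^ a *
      (a * besselMoment a (u ^ 2) 0 - u ^ 2 / 2 * besselMoment (a + 1) (u ^ 2) 0) / u := by
  have h1 : HasDerivAt (fun v : ℝ => (v / 2) ^ a) (1 / 2 * a * (u / 2) ^ (a - 1)) u :=
    ((hasDerivAt_id u).div_const 2).rpow_const (Or.inl (by simp; positivity))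
  have h2 : HasDerivAt (fun v : ℝ => besselMoment a (v ^ 2) 0)
      (-1 / 4 * besselMoment (a + 1) (u ^ 2) 0 * (2 * u)) u := by
    have hp : HasDerivAt (fun v : ℝ => v ^ 2) (2 * u) u := by simpa using hasDerivAt_pow 2 u
    exact (hasDerivAt_besselMoment_zero ha (u ^ 2)).comp u hp
  have h3 : besselJ a =ᶠ[𝓝 u] fun v => (v / 2) ^ a * besselMoment a (v ^ 2) 0 :=
    (lt_mem_nhds hu).mono fun v hv => besselJ_eq a hv
  rw [besselJ', h3.deriv_eq, (h1.fun_mul h2).deriv, Real.rpow_sub_one (by positivity)]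
  field_simp
  ring

/-! ### The coefficients of the expansion -/

section Coefficients

variable {a y : ℝ}

lemma sqrt_half_rpow_mul_self (a : ℝ) (hy : 0 < y) :
    (√y / 2) ^ a * (√y / 2) ^ a = 4 * (y ^ a / 4 ^ (a + 1)) := by
  have h4 : (4 : ℝ) ^ a ≠ 0 := (Real.rpow_pos_of_pos (by norm_num) a).ne'
  rw [← Real.mul_rpow (by positivity) (by positivity),
    show √y / 2 * (√y / 2) = y / 4 by rw [div_mul_div_comm, Real.mul_self_sqrt hy.le]; norm_num,
    Real.div_rpow hy.le (by norm_num), Real.rpow_add_one (by norm_num)]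
  field_simp

lemma besselJ_sqrt (ν : ℝ) (hy : 0 < y) :
    besselJ ν (√y) = (√y / 2) ^ ν * besselMoment ν y 0 := by
  rw [besselJ_eq ν (Real.sqrt_pos.2 hy), Real.sq_sqrt hy.le]

lemma besselJ'_sqrt (ha : -1 < a) (hy : 0 < y) :
    besselJ' a (√y) = (√y / 2) ^ a *
      (a * besselMoment a y 0 - y / 2 * besselMoment (a + 1) y 0) / √y := by
  rw [besselJ'_eq ha (Real.sqrt_pos.2 hy), Real.sq_sqrt hy.le]

lemma r₀_eq (ha : -1 < a) (hy : 0 < y) :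
    r₀ a y = y ^ a / 4 ^ (a + 1) *
      ((a + 1 + y / 4) * besselMoment (a + 1) y 0 ^ 2 +
        (a + 2) * besselMoment (a + 1) y 0 * besselMoment (a + 1) y 1 +
        besselMoment (a + 1) y 1 ^ 2) := by
  have hu : 0 < √y := Real.sqrt_pos.2 hy
  have hP := sqrt_half_rpow_mul_self a hy
  rw [r₀, besselJ_sqrt a hy, besselJ_sqrt (a + 1) hy, besselJ_sqrt (a - 1) hy,
    besselMoment_zero_eq ha, besselMoment_sub_one_zero_eq ha, Real.rpow_add_one (by positivity),
    Real.rpow_sub_one (by positivity)]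
  generalize (√y / 2) ^ a = P at hP ⊢
  generalize besselMoment (a + 1) y 0 = M₀
  generalize besselMoment (a + 1) y 1 = M₁
  have hcancel : P * (√y / 2) * M₀ * (P / (√y / 2) * ((a * (a + 1) - y / 4) * M₀ + a * M₁)) =
      P * P * M₀ * ((a * (a + 1) - y / 4) * M₀ + a * M₁) := by
    field_simp
  rw [hcancel]
  linear_combination 1 / 4 * ((a + 1 + y / 4) * M₀ ^ 2 + (a + 2) * M₀ * M₁ + M₁ ^ 2) * hP

/-- Here A and B are J_a(√y) and √y J_a'(√y) without their common factor (√y/2)^a. The square of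
that factor gives the prefactor y^a/4^(a+1) seen in `hardEdgeDensity_succ_eq`, up to 4. -/
lemma r₁_eq (ha : -1 < a) (hy : 0 < y) {A B : ℝ}
    (hA : A = (a + 1) * besselMoment (a + 1) y 0 + besselMoment (a + 1) y 1)
    (hB : B = a * A - y / 2 * besselMoment (a + 1) y 0) :
    r₁ a y = y ^ a / 4 ^ (a + 1) *
      (-(1 / 48) * ((2 * y + a ^ 2) * A ^ 2 + 4 * A * B + B ^ 2)) := by
  have hu : 0 < √y := Real.sqrt_pos.2 hy
  have hP := sqrt_half_rpow_mul_self a hy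
  rw [r₁, besselJ'_sqrt ha hy, besselJ_sqrt a hy, besselMoment_zero_eq ha, ← hA, ← hB]
  generalize (√y / 2) ^ a = P at hP ⊢
  have e1 : 4 * √y * (P * A) * (P * B / √y) = 4 * (P * P) * (A * B) := by field_simp
  have e2 : y * (P * B / √y) ^ 2 = P * P * B ^ 2 := by
    rw [div_pow, Real.sq_sqrt hy.le]; field_simp
  rw [e1, e2]
  linear_combination -(1 / 192) * ((2 * y + a ^ 2) * A ^ 2 + 4 * A * B + B ^ 2) * hP

lemma r₂_eq (ha : -1 < a) (hy : 0 < y) {A B : ℝ}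
    (hA : A = (a + 1) * besselMoment (a + 1) y 0 + besselMoment (a + 1) y 1)
    (hB : B = a * A - y / 2 * besselMoment (a + 1) y 0) :
    r₂ a y = y ^ a / 4 ^ (a + 1) * (1 / 23040 *
      ((14 * a ^ 2 * (-4 + a ^ 2) + 2 * (48 - 9 * a ^ 2) * y - 26 * y ^ 2) * A ^ 2 +
        (14 * (-4 + a ^ 2) + 6 * y) * B ^ 2 +
        (192 - 128 * a ^ 2 + 20 * a ^ 4 + (-104 + 20 * a ^ 2) * y + 5 * y ^ 2) * (A * B))) := by
  have hu : 0 < √y := Real.sqrt_pos.2 hy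
  have hP := sqrt_half_rpow_mul_self a hy
  rw [r₂, besselJ'_sqrt ha hy, besselJ_sqrt a hy, besselMoment_zero_eq ha, ← hA, ← hB]
  generalize (√y / 2) ^ a = P at hP ⊢
  have e1 : 1 / √y * (P * A) * (P * B / √y) = P * P * (A * B) / y := by
    rw [show 1 / √y * (P * A) * (P * B / √y) = P * P * (A * B) / (√y * √y) by field_simp,
      Real.mul_self_sqrt hy.le]
  have e2 : (P * B / √y) ^ 2 = P * P * B ^ 2 / y := by
    rw [div_pow, Real.sq_sqrt hy.le]; ring
  have e3 : 1 / y * (P * A) ^ 2 = P * P * A ^ 2 / y := by ring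
  rw [e1, e2, e3, hP, α₂, β₂, γ₂]
  field_simp
  ring

/-- The moments of order at most seven in terms of the first two. -/
lemma besselMoment_reduction {ν : ℝ} (hν : 0 ≤ ν) (y : ℝ) :
    (besselMoment ν y 2 = -ν * besselMoment ν y 1 - y / 4 * besselMoment ν y 0) ∧
    (besselMoment ν y 3 = -ν * besselMoment ν y 2 -
      y / 4 * (besselMoment ν y 0 + besselMoment ν y 1)) ∧
    (besselMoment ν y 4 = -ν * besselMoment ν y 3 -
      y / 4 * (besselMoment ν y 0 + 2 * besselMoment ν y 1 + besselMoment ν y 2)) ∧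
    (besselMoment ν y 5 = -ν * besselMoment ν y 4 -
      y / 4 * (besselMoment ν y 0 + 3 * besselMoment ν y 1 + 3 * besselMoment ν y 2 +
        besselMoment ν y 3)) ∧
    (besselMoment ν y 6 = -ν * besselMoment ν y 5 -
      y / 4 * (besselMoment ν y 0 + 4 * besselMoment ν y 1 + 6 * besselMoment ν y 2 +
        4 * besselMoment ν y 3 + besselMoment ν y 4)) ∧
    (besselMoment ν y 7 = -ν * besselMoment ν y 6 -
      y / 4 * (besselMoment ν y 0 + 5 * besselMoment ν y 1 + 10 * besselMoment ν y 2 +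
        10 * besselMoment ν y 3 + 5 * besselMoment ν y 4 + besselMoment ν y 5)) := by
  refine ⟨?_, ?_, ?_, ?_, ?_, ?_⟩
  · simpa [Finset.sum_range_succ, Nat.choose] using besselMoment_add_two hν y 0
  · simpa [Finset.sum_range_succ, Nat.choose] using besselMoment_add_two hν y 1
  · simpa [Finset.sum_range_succ, Nat.choose] using besselMoment_add_two hν y 2
  · simpa [Finset.sum_range_succ, Nat.choose] using besselMoment_add_two hν y 3
  · simpa [Finset.sum_range_succ, Nat.choose] using besselMoment_add_two hν y 4
  · simpa [Finset.sum_range_succ, Nat.choose] using besselMoment_add_two hν y 5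

end Coefficients

/-! ### The expansion of the density -/

lemma hasExpansion_tsum {ν : ℝ} (hν : 0 ≤ ν) (y : ℝ) (k : ℕ) {ε : ℕ → ℝ}
    (hε : Tendsto ε atTop (𝓝 0)) (hε0 : ∀ n, 0 ≤ ε n) :
    HasExpansion ε
      (fun n => ∑' m : ℕ, (m : ℝ) ^ k * (besselCoeff ν m * finiteSizeFactor ν (ε n) m * y ^ m))
      (besselMoment ν y k) (momentOne ν y k) (momentTwo ν y k) := by
  refine IsBigO.of_bound
    (∑' m : ℕ, (m : ℝ) ^ k * (|besselCoeff ν m| * finiteSizeFactor ν 1 m * |y| ^ m)) ?_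
  filter_upwards [hε.eventually (ge_mem_nhds zero_lt_one)] with n hn
  rw [Real.norm_eq_abs, Real.norm_eq_abs, abs_of_nonneg (pow_nonneg (hε0 n) 3)]
  exact abs_tsum_finiteSizeFactor_sub_le hν y k (hε0 n) hn

lemma hasExpansion_scaledLaguerre {ν : ℝ} (hν : 0 ≤ ν) (y : ℝ) {ε : ℕ → ℝ}
    (hε : Tendsto ε atTop (𝓝 0)) (hε0 : ∀ n, 0 ≤ ε n) :
    HasExpansion ε (fun n => scaledLaguerre ν (ε n) y)
      (besselMoment ν y 0) (momentOne ν y 0) (momentTwo ν y 0) := by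
  simpa [scaledLaguerre] using hasExpansion_tsum hν y 0 hε hε0

lemma hasExpansion_eulerScaledLaguerre {ν : ℝ} (hν : 0 ≤ ν) (y : ℝ) {ε : ℕ → ℝ}
    (hε : Tendsto ε atTop (𝓝 0)) (hε0 : ∀ n, 0 ≤ ε n) :
    HasExpansion ε (fun n => eulerScaledLaguerre ν (ε n) y)
      (besselMoment ν y 1) (momentOne ν y 1) (momentTwo ν y 1) := by
  simpa only [eulerScaledLaguerre, pow_one] using hasExpansion_tsum hν y 1 hε hε0

lemma hasExpansion_hardEdgeDensity {a : ℝ} (ha : -1 < a) {y : ℝ} (hy : 0 < y) :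
    HasExpansion (fun n => 1 / shiftedSize a (n + 1) ^ 2) (fun n => hardEdgeDensity a (n + 1) y)
      (r₀ a y) (r₁ a y) (r₂ a y) := by
  have hs : 0 < a + 1 := by linarith
  have hκ (n : ℕ) : shiftedSize a (n + 1) = n + ((a + 1) + 1) / 2 := by
    rw [shiftedSize]; push_cast; ring
  set ε : ℕ → ℝ := fun n => 1 / ((n : ℝ) + ((a + 1) + 1) / 2) ^ 2 with hεdef
  have hε : Tendsto ε atTop (𝓝 0) := by
    have h := (tendsto_natCast_add_atTop (((a + 1) + 1) / 2)).inv_tendsto_atTop.pow 2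
    refine (h.congr fun n => ?_).trans (by simp)
    simp [hεdef]
  have hε0 (n : ℕ) : 0 ≤ ε n := by simp only [hεdef]; positivity
  have hF := hasExpansion_scaledLaguerre hs.le y hε hε0
  have hG := hasExpansion_eulerScaledLaguerre hs.le y hε hε0
  have hcoef : HasExpansion ε (fun n => a + 1 + y / 4 + -(y ^ 2 / 64) * ε n)
      (a + 1 + y / 4 + -(y ^ 2 / 64) * 0) (0 + -(y ^ 2 / 64) * 1) (0 + -(y ^ 2 / 64) * 0) :=
    (HasExpansion.const _).add (HasExpansion.self.const_mul hε _)
  have hQ := (((hcoef.mul hε (hF.mul hε hF)).add ((hF.mul hε hG).const_mul hε (a + 2))).add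
    (hG.mul hε hG)).const_mul hε (y ^ a / 4 ^ (a + 1))
  have hmain := (hasExpansion_gammaRatio hs).mul hε hQ
  have hεκ : (fun n => 1 / shiftedSize a (n + 1) ^ 2) = ε := by
    funext n; simp only [hεdef, hκ]
  rw [hεκ]
  -- Order seven is the highest needed, from `momentTwo` at k = 1. Rewriting from the highest order
  -- down leaves polynomial identities in a, y and the moments of order 0 and 1.
  obtain ⟨h2, h3, h4, h5, h6, h7⟩ := besselMoment_reduction hs.le y
  refine (hmain.congr' (Eventually.of_forall fun n => ?_)).congr_coeff ?_ ?_ ?_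
  · simp only
    rw [hardEdgeDensity_succ_eq ha n hy (hκ n).symm, gammaRatio]
    simp only [hεdef]
    ring
  · rw [r₀_eq ha hy]
    ring
  · rw [r₁_eq ha hy rfl rfl]
    simp only [momentOne, logGammaOne, zero_add, Nat.reduceAdd]
    rw [h4, h3, h2]
    ring
  · rw [r₂_eq ha hy rfl rfl]
    simp only [momentOne, momentTwo, logGammaOne, logGammaTwo, zero_add, Nat.reduceAdd]
    rw [h7, h6, h5, h4, h3, h2]
    ring

end

end LUEHardEdge

end

theorem mainTheorem1 (a : ℝ) (ha : -1 < a) (y : ℝ) (hy : 0 < y) :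
    (fun N : ℕ => LUEHardEdge.hardEdgeDensity a N y
        - (LUEHardEdge.r₀ a y
          + LUEHardEdge.r₁ a y / LUEHardEdge.shiftedSize a N ^ 2
          + LUEHardEdge.r₂ a y / LUEHardEdge.shiftedSize a N ^ 4))
      =O[atTop] (fun N : ℕ => 1 / LUEHardEdge.shiftedSize a N ^ 6) := by
  -- The exact formula concerns N = n + 1; the value at N = 0 does not affect the limit.
  rw [← map_add_atTop_eq_nat 1, isBigO_map]
  refine (LUEHardEdge.hasExpansion_hardEdgeDensity ha hy).congr (fun n => ?_) fun n => ?_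
  · simp only [Function.comp_apply]
    ring
  · simp only [Function.comp_apply]
    rw [one_div_pow, ← pow_mul]
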